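/- Let $n\ge 3$ and let $\mathbb R^{n+1,1}$ be the Lorentzian space with metric $(\cdot,\cdot)$ and light-cone $\mathcal L$, so that $S^n\cong\mathbb P(\mathcal L)$ is the conformal $n$-sphere. Identify $u\wedge v$, for $u,v\in\mathbb R^{n+1,1}$, with the skew endomorphism $w\mapsto (u,w)v-(v,w)u$. Let $\Sigma$ be a connected oriented surface and $\Lambda:\Sigma\to\mathbb P(\mathcal L)$ a smooth immersion whose image is not contained in any proper subsphere of $S^n$, regarded as a null line subbundle of $\Sigma\times\mathbb R^{n+1,1}$. Equip $\Sigma$ with the Riemann surface structure determined by its orientation and the conformal structure induced by $\Lambda$ (so that $\Lambda$ is a conformal immersion of a Riemann surface), let $J$ be the complex structure on $T\Sigma$, and put $*\omega=-\omega\circ J$ for $1$-forms $\omega$. For a lift $\sigma$ of $\Lambda$ (a never-zero smooth section) and a holomorphic chart $z$, let $$\Lambda^{(1)}=\langle\sigma,d\sigma(T\Sigma)\rangle,\qquad S=\langle\sigma,d\sigma(T\Sigma),\sigma_{z\bar z}\rangle ,$$ the latter being the central sphere congruence of $\Lambda$; these do not depend on the choices. Let $\pi_S$ be the orthogonal projection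 onto $S$, and write $d=\mathcal D+\mathcal N$, where $\mathcal D=\pi_S\circ d\circ\pi_S+(1-\pi_S)\circ d\circ(1-\pi_S)$. For $1$-forms with values in endomorphisms let $[\omega\wedge\eta](X,Y)=[\omega_X,\eta_Y]-[\omega_Y,\eta_X]$, and let $d^{\mathcal D}\omega=d\omega-[\mathcal N\wedge\omega]$ be the exterior derivative for the connection induced by $\mathcal D$. A *multiplier* for $\Lambda$ is a smooth real $1$-form $q\in\Omega^1(\Lambda\wedge\Lambda^{(1)})$ with $$d^{\mathcal D}q=0\qquad\text{and}\qquad d^{\mathcal D}{*\mathcal N}=2\,[q\wedge *\mathcal N];$$ $\Lambda$ is then called a $q$-constrained Willmore surface, and $\Lambda$ is a *constrained Willmore surface* if it has a multiplier. $(\Lambda,\eta)$ is *isothermic* if $\eta\in\Omega^1(\Lambda\wedge\Lambda^{(1)})$ is a smooth real $1$-form, not identically zero, with $d\eta=0$; $\Lambda$ is *isothermic* if such an $\eta$ exists. Then: 1. If $\Lambda$ is a constrained Willmore surface, then $\Lambda$ has a unique multiplier if and only if $\Lambda$ is not isothermic. 2. If $q_1\ne q_2$ are multipliers for $\Lambda$,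 then $(\Lambda,*(q_1-q_2))$ is isothermic. 3. If $(\Lambda,\eta)$ is isothermic and $q$ is a multiplier for $\Lambda$, then the set of all multipliers for $\Lambda$ is $\{\,q+t\,{*\eta} : t\in\mathbb R\,\}$. -/

import Mathlib

open Set Topology
open scoped Manifold ContDiff

noncomputable section

namespace CWSurface

/-! ### The Lorentzian space `ℝ^{n+1,1}` and its orthogonal algebra -/

/-- The underlying vector space `ℝ^{n+1} × ℝ` of the Lorentzian space `ℝ^{n+1,1}`. -/
abbrev Mink (n : ℕ) : Type := EuclideanSpace ℝ (Fin (n + 1)) × ℝ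

/-- The Lorentzian metric `(u, v) = u₁v₁ + ⋯ + u_{n+1}v_{n+1} - u_{n+2}v_{n+2}`. -/
def lor (n : ℕ) : LinearMap.BilinForm ℝ (Mink n) :=
  LinearMap.mk₂ ℝ (fun u v => inner ℝ u.1 v.1 - u.2 * v.2)
    (fun u u' v => by simp only [Prod.fst_add, Prod.snd_add, inner_add_left]; ring)
    (fun c u v => by
      simp only [Prod.smul_fst, Prod.smul_snd, real_inner_smul_left, smul_eq_mul]; ring)
    (fun u v v' => by simp only [Prod.fst_add, Prod.snd_add, inner_add_right]; ring)
    (fun c u v => by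
      simp only [Prod.smul_fst, Prod.smul_snd, real_inner_smul_right, smul_eq_mul]; ring)

/-- Endomorphisms of `ℝ^{n+1,1}`. -/
abbrev MinkEnd (n : ℕ) : Type := Mink n →L[ℝ] Mink n

/-- `u ∧ v` as an element of the orthogonal algebra: `(u ∧ v) w = (u, w) v - (v, w) u`. -/
def wedge {n : ℕ} (u v : Mink n) : MinkEnd n :=
  LinearMap.toContinuousLinearMap ((lor n u).smulRight v - (lor n v).smulRight u)

/-- The linear map `T ↦ A ∘ T ∘ B` on endomorphisms. -/
def sandwich {n : ℕ} (A B : MinkEnd n) : MinkEnd n →L[ℝ] MinkEnd n :=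
  (ContinuousLinearMap.compL ℝ (Mink n) (Mink n) (Mink n) A).comp
    ((ContinuousLinearMap.compL ℝ (Mink n) (Mink n) (Mink n)).flip B)

/-- `A ∧ B`, the span of all `u ∧ v` with `u ∈ A` and `v ∈ B`. -/
def wedgeSpan {n : ℕ} (A B : Submodule ℝ (Mink n)) : Submodule ℝ (MinkEnd n) :=
  Submodule.span ℝ {T | ∃ u ∈ A, ∃ v ∈ B, T = wedge u v}

/-- The orthogonal projection of `ℝ^{n+1,1}` onto a non-degenerate subspace `W`
(`0` if `W` is degenerate). -/
def orthProj {n : ℕ} (W : Submodule ℝ (Mink n)) : MinkEnd n :=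
  open Classical in
  if h : IsCompl W ((lor n).orthogonal W) then LinearMap.toContinuousLinearMap (Submodule.projection W _ h) else 0

/-! ### Vector-valued forms on a Riemann surface

A Riemann surface is a manifold `M` modelled on `ℂ` with holomorphic transition maps.  Its real
tangent space at `x` is identified with `ℂ` by the preferred holomorphic chart at `x`. -/

variable {M : Type*} [TopologicalSpace M] [ChartedSpace ℂ M]

/-- The complex structure on the real tangent space: multiplication by `i` in a holomorphic
chart. -/
def J (x : M) : TangentSpace 𝓘(ℝ, ℂ) x →L[ℝ] TangentSpace 𝓘(ℝ, ℂ) x :=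
  (ContinuousLinearMap.mul ℝ ℂ Complex.I : ℂ →L[ℝ] ℂ)

variable (M) in
/-- Real `1`-forms on `M` with values in a vector space `F` (with no regularity). -/
abbrev OneForm (F : Type*) [NormedAddCommGroup F] [NormedSpace ℝ F] : Type _ :=
  ∀ x : M, TangentSpace 𝓘(ℝ, ℂ) x →L[ℝ] F

section Forms

variable {F : Type*} [NormedAddCommGroup F] [NormedSpace ℝ F]

/-- The pull-back of a `1`-form to `ℂ` by the inverse of the preferred chart at `x₀`
(meaningful on the target of that chart). -/
def OneForm.inChart (α : OneForm M F) (x₀ : M) : ℂ → ℂ →L[ℝ] F := fun z =>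
  (α ((chartAt ℂ x₀).symm z)).comp (mfderiv 𝓘(ℝ, ℂ) 𝓘(ℝ, ℂ) (chartAt ℂ x₀).symm z)

/-- Smoothness of a `1`-form. -/
def OneForm.IsSmooth (α : OneForm M F) : Prop :=
  ∀ x₀ : M, ContDiffOn ℝ ∞ (α.inChart x₀) (chartAt ℂ x₀).target

/-- The exterior derivative `dα (X, Y)` at `x` of a `1`-form. -/
def OneForm.extD (α : OneForm M F) (x : M) (X Y : TangentSpace 𝓘(ℝ, ℂ) x) : F :=
  fderiv ℝ (α.inChart x) (chartAt ℂ x x) X Y - fderiv ℝ (α.inChart x) (chartAt ℂ x x) Y X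

/-- The Hodge star on `1`-forms of the conformal structure of `M`: `*α = -α ∘ J`. -/
def OneForm.star (α : OneForm M F) : OneForm M F := fun x => -((α x).comp (J x))

end Forms

/-- `[α ∧ η] (X, Y) = [α_X, η_Y] - [α_Y, η_X]`. -/
def bracketWedge {n : ℕ} (α η : OneForm M (MinkEnd n)) (x : M)
    (X Y : TangentSpace 𝓘(ℝ, ℂ) x) : MinkEnd n :=
  ⁅α x X, η x Y⁆ - ⁅α x Y, η x X⁆

/-! ### Surfaces in the conformal `n`-sphere

A map from `M` to the projectivised light-cone `S^n ≅ ℙ(𝓛)` is a null line subbundle `Λ` of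
`M × ℝ^{n+1,1}`, i.e. a map from `M` to the subspaces of `ℝ^{n+1,1}`. -/

variable {n : ℕ}

/-- `σ` is a (smooth, never-zero) lift of the line bundle `Λ`. -/
structure IsLift (Λ : M → Submodule ℝ (Mink n)) (σ : M → Mink n) : Prop where
  smooth : ContMDiff 𝓘(ℝ, ℂ) 𝓘(ℝ, Mink n) ∞ σ
  ne_zero : ∀ x, σ x ≠ 0
  span_eq : ∀ x, Λ x = Submodule.span ℝ {σ x}

/-- The derivative `d_X σ` of an `ℝ^{n+1,1}`-valued function. -/
abbrev dvec (σ : M → Mink n) (x : M) : TangentSpace 𝓘(ℝ, ℂ) x →L[ℝ] Mink n :=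
  mfderiv 𝓘(ℝ, ℂ) 𝓘(ℝ, Mink n) σ x

/-- The Laplacian `4 σ_{z z̄}` at `x` of `σ` with respect to the preferred holomorphic chart
`z` at `x`. -/
def chartLaplacian (σ : M → Mink n) (x : M) : Mink n :=
  Laplacian.laplacian (fun z : ℂ => σ ((chartAt ℂ x).symm z)) (chartAt ℂ x x)

/-- `Λ` is a conformal immersion of the Riemann surface `M` in `S^n ≅ ℙ(𝓛)` (so that the
complex structure of `M` is the one given by its orientation and the conformal structure induced
by `Λ`) whose image is not contained in any proper subsphere of `S^n`. -/
structure IsSurface (Λ : M → Submodule ℝ (Mink n)) : Prop where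
  exists_lift : ∃ σ, IsLift Λ σ
  null : ∀ x, ∀ v ∈ Λ x, lor n v v = 0
  /-- The differential of `Λ`, which sends `X` to the class of `d_X σ` modulo `Λ`, is injective. -/
  immersion : ∀ σ, IsLift Λ σ → ∀ x (X : TangentSpace 𝓘(ℝ, ℂ) x), dvec σ x X ∈ Λ x → X = 0
  conformal : ∀ σ, IsLift Λ σ → ∀ x (X Y : TangentSpace 𝓘(ℝ, ℂ) x),
    lor n (dvec σ x (J x X)) (dvec σ x (J x Y)) = lor n (dvec σ x X) (dvec σ x Y)
  /-- The hyperspheres of `S^n` are given by the hyperplanes orthogonal to space-like vectors. -/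
  full : ∀ v : Mink n, 0 < lor n v v → ∃ x, ∃ w ∈ Λ x, lor n w v ≠ 0

/-- `Λ^{(1)} = ⟨σ, dσ(TM)⟩`, for any lift `σ` (the span does not depend on the lift). -/
def firstBundle (Λ : M → Submodule ℝ (Mink n)) (x : M) : Submodule ℝ (Mink n) :=
  Submodule.span ℝ {v | ∃ σ, IsLift Λ σ ∧ (v = σ x ∨ ∃ X, v = dvec σ x X)}

/-- The central sphere congruence `S = ⟨σ, dσ(TM), σ_{z z̄}⟩`, for any lift `σ`
(the span does not depend on the lift, nor on the holomorphic chart). -/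
def centralSphere (Λ : M → Submodule ℝ (Mink n)) (x : M) : Submodule ℝ (Mink n) :=
  Submodule.span ℝ {v | ∃ σ, IsLift Λ σ ∧
    (v = σ x ∨ (∃ X, v = dvec σ x X) ∨ v = chartLaplacian σ x)}

/-- The orthogonal projection `π_S` onto the central sphere congruence. -/
def projS (Λ : M → Submodule ℝ (Mink n)) (x : M) : MinkEnd n := orthProj (centralSphere Λ x)

/-- The derivative of `π_S`, a `1`-form with values in endomorphisms. -/
def dProjS (Λ : M → Submodule ℝ (Mink n)) : OneForm M (MinkEnd n) := fun x =>
  mfderiv 𝓘(ℝ, ℂ) 𝓘(ℝ, MinkEnd n) (projS Λ) x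

/-- The connection `𝓓 = π_S ∘ d ∘ π_S + (1 - π_S) ∘ d ∘ (1 - π_S)`, the sum of the connections
induced by `d` on `S` and `S^⊥`, on sections of the trivial bundle. -/
def connD (Λ : M → Submodule ℝ (Mink n)) (ξ : M → Mink n) (x : M) :
    TangentSpace 𝓘(ℝ, ℂ) x →L[ℝ] Mink n :=
  (projS Λ x).comp (dvec (fun y => projS Λ y (ξ y)) x) +
    (1 - projS Λ x).comp (dvec (fun y => (1 - projS Λ y) (ξ y)) x)

/-- The tensorial part `𝓝 = d - 𝓓 = (1 - π_S) ∘ d ∘ π_S + π_S ∘ d ∘ (1 - π_S)` of `d`.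
On a constant section `v`, one has `d_X (π_S v) = (d_X π_S) v` and
`d_X ((1 - π_S) v) = -(d_X π_S) v`, so that
`𝓝_X = (1 - π_S) (d_X π_S) π_S - π_S (d_X π_S) (1 - π_S)`. -/
def formN (Λ : M → Submodule ℝ (Mink n)) : OneForm M (MinkEnd n) := fun x =>
  (sandwich (1 - projS Λ x) (projS Λ x) - sandwich (projS Λ x) (1 - projS Λ x)).comp (dProjS Λ x)

theorem orthProj_apply_orthProj (W : Submodule ℝ (Mink n)) (v : Mink n) :
    orthProj W (orthProj W v) = orthProj W v := by
  unfold orthProj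
  split_ifs with h
  · simp
  · simp

/-- The decomposition `d = 𝓓 + 𝓝` on sections. -/
theorem dvec_eq_connD_add_formN (Λ : M → Submodule ℝ (Mink n)) (ξ : M → Mink n) (x : M)
    (hπ : MDifferentiableAt 𝓘(ℝ, ℂ) 𝓘(ℝ, MinkEnd n) (projS Λ) x)
    (hξ : MDifferentiableAt 𝓘(ℝ, ℂ) 𝓘(ℝ, Mink n) ξ x) (X : TangentSpace 𝓘(ℝ, ℂ) x) :
    dvec ξ x X = connD Λ ξ x X + formN Λ x X (ξ x) := by
  have hev : ∀ (P : M → MinkEnd n) (dP : TangentSpace 𝓘(ℝ, ℂ) x →L[ℝ] MinkEnd n) (ζ : M → Mink n)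
      (dζ : TangentSpace 𝓘(ℝ, ℂ) x →L[ℝ] Mink n),
      HasMFDerivAt 𝓘(ℝ, ℂ) 𝓘(ℝ, MinkEnd n) P x dP → HasMFDerivAt 𝓘(ℝ, ℂ) 𝓘(ℝ, Mink n) ζ x dζ →
      (dvec (fun y => P y (ζ y)) x X : Mink n) = dP X (ζ x) + P x (dζ X) := by
    intro P dP ζ dζ hP hζ
    have h : HasMFDerivAt 𝓘(ℝ, ℂ) 𝓘(ℝ, Mink n) (fun y => P y (ζ y)) x _ :=
      ⟨hP.1.clm_apply hζ.1, hP.2.clm_apply hζ.2⟩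
    refine (DFunLike.congr_fun h.mfderiv X).trans ?_
    refine (add_comm _ _).trans ?_
    simp [writtenInExtChartAt]
    rfl
  have key : ∀ (p A : MinkEnd n) (v w : Mink n), (∀ u, p (p u) = p u) →
      (∀ u, A u = A (p u) + p (A u)) →
      w = p (A v + p w) + (1 - p) (-A v + (1 - p) w) + ((1 - p) (A (p v)) - p (A ((1 - p) v))) := by
    intro p A v w hp hA
    have h1 := hA v
    have h2 := hA (p v)
    simp only [hp, left_eq_add] at h2
    simp only [map_add, map_sub, map_neg, sub_apply,
      one_apply_eq_self, hp, h2]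
    rw [h1]
    simp only [map_add, hp, h2]
    abel
  have hd := hπ.hasMFDerivAt
  have hp : ∀ v, projS Λ x (projS Λ x v) = projS Λ x v := fun v => orthProj_apply_orthProj _ v
  have hconst : ∀ u : Mink n, (dvec (fun y => projS Λ y u) x X : Mink n) = dProjS Λ x X u := by
    intro u
    have h := hev _ _ (fun _ => u) 0 hd (hasMFDerivAt_const u x)
    exact h.trans ((congrArg (dProjS Λ x X u + ·) (map_zero (projS Λ x))).trans (add_zero _))
  have hA : ∀ u : Mink n, (dProjS Λ x X u : Mink n) =
      dProjS Λ x X (projS Λ x u) + projS Λ x (dProjS Λ x X u) := by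
    intro u
    have hu : MDifferentiableAt 𝓘(ℝ, ℂ) 𝓘(ℝ, Mink n) (fun y => projS Λ y u) x := by
      have h : HasMFDerivAt 𝓘(ℝ, ℂ) 𝓘(ℝ, Mink n) (fun y => projS Λ y u) x _ :=
        ⟨hd.1.clm_apply continuousAt_const, hd.2.clm_apply (hasFDerivWithinAt_const u _ _)⟩
      exact h.mdifferentiableAt
    have h := hev _ _ _ _ hd hu.hasMFDerivAt
    have hf : (fun y => projS Λ y (projS Λ y u)) = fun y => projS Λ y u :=
      funext fun y => orthProj_apply_orthProj _ u
    rw [hf] at h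
    exact ((hconst u).symm.trans h).trans
      (congrArg (fun z => dProjS Λ x X (projS Λ x u) + projS Λ x z) (hconst u))
  have h1 := hev _ _ _ _ hd hξ.hasMFDerivAt
  have h2 : (dvec (fun y => (1 - projS Λ y) (ξ y)) x X : Mink n) =
      - dProjS Λ x X (ξ x) + (1 - projS Λ x) (dvec ξ x X) := by
    have h := hev (fun y => 1 - projS Λ y) (0 - dProjS Λ x) _ _
      ((hasMFDerivAt_const (1 : MinkEnd n) x).sub hd) hξ.hasMFDerivAt
    refine h.trans (congrArg (· + (1 - projS Λ x : MinkEnd n) (dvec ξ x X)) ?_)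
    have h0 : (0 - dProjS Λ x : TangentSpace 𝓘(ℝ, ℂ) x →L[ℝ] MinkEnd n) X = - dProjS Λ x X :=
      zero_sub (dProjS Λ x X)
    exact DFunLike.congr_fun h0 (ξ x)
  have e : connD Λ ξ x X = projS Λ x (dvec (fun y => projS Λ y (ξ y)) x X) +
      (1 - projS Λ x) (dvec (fun y => (1 - projS Λ y) (ξ y)) x X) := rfl
  have e' : formN Λ x X (ξ x) = (1 - projS Λ x) (dProjS Λ x X (projS Λ x (ξ x))) -
      projS Λ x (dProjS Λ x X ((1 - projS Λ x) (ξ x))) := rfl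
  refine (key (projS Λ x) (dProjS Λ x X) (ξ x) (dvec ξ x X) hp hA).trans ?_
  refine Eq.trans ?_ (congrArg₂ (· + ·) e e').symm
  refine congrArg₂ (· + ·) (congrArg₂ (· + ·) ?_ ?_) rfl
  · exact congrArg (projS Λ x) h1.symm
  · exact congrArg (1 - projS Λ x : MinkEnd n) h2.symm

/-- The exterior derivative `d^𝓓` of a `1`-form with values in endomorphisms, for the connection
`𝓓 ξ = 𝓓 ∘ ξ - ξ ∘ 𝓓 = d ξ - [𝓝, ξ]` on endomorphisms: `d^𝓓 α = dα - [𝓝 ∧ α]`. -/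
def extDD (Λ : M → Submodule ℝ (Mink n)) (α : OneForm M (MinkEnd n)) (x : M)
    (X Y : TangentSpace 𝓘(ℝ, ℂ) x) : MinkEnd n :=
  α.extD x X Y - bracketWedge (formN Λ) α x X Y

/-! ### Multipliers, constrained Willmore surfaces, isothermic surfaces -/

/-- `α` is a smooth real `1`-form with values in `Λ ∧ Λ^{(1)}`. -/
structure IsAdmissible (Λ : M → Submodule ℝ (Mink n)) (α : OneForm M (MinkEnd n)) : Prop where
  smooth : α.IsSmooth
  mem : ∀ x (X : TangentSpace 𝓘(ℝ, ℂ) x), α x X ∈ wedgeSpan (Λ x) (firstBundle Λ x)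

/-- `q` is a (Lagrange) multiplier for `Λ`, i.e. `Λ` is a `q`-constrained Willmore surface:
`q ∈ Ω¹(Λ ∧ Λ^{(1)})` is real, `d^𝓓 q = 0` and `d^𝓓 *𝓝 = 2 [q ∧ *𝓝]`. -/
structure IsMultiplier (Λ : M → Submodule ℝ (Mink n)) (q : OneForm M (MinkEnd n)) : Prop where
  admissible : IsAdmissible Λ q
  closed : ∀ x (X Y : TangentSpace 𝓘(ℝ, ℂ) x), extDD Λ q x X Y = 0
  euler_lagrange : ∀ x (X Y : TangentSpace 𝓘(ℝ, ℂ) x),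
    extDD Λ (formN Λ).star x X Y = (2 : ℝ) • bracketWedge q (formN Λ).star x X Y

/-- `Λ` is a constrained Willmore surface. -/
def IsConstrainedWillmore (Λ : M → Submodule ℝ (Mink n)) : Prop := ∃ q, IsMultiplier Λ q

/-- `(Λ, η)` is an isothermic surface: `η ∈ Ω¹(Λ ∧ Λ^{(1)})` is real, non-zero and closed. -/
structure IsIsothermicPair (Λ : M → Submodule ℝ (Mink n)) (η : OneForm M (MinkEnd n)) :
    Prop where
  admissible : IsAdmissible Λ η
  ne_zero : η ≠ 0
  closed : ∀ x (X Y : TangentSpace 𝓘(ℝ, ℂ) x), η.extD x X Y = 0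

/-- `Λ` is an isothermic surface. -/
def IsIsothermic (Λ : M → Submodule ℝ (Mink n)) : Prop := ∃ η, IsIsothermicPair Λ η

end CWSurface

end

open Set Topology
open scoped Manifold ContDiff

noncomputable section

namespace CWSurface

section

variable {n : ℕ}

/-! ### Algebra of the Lorentzian metric -/

/-! Normalise the lift `σ` of Λ to have last coordinate 1, and work in a holomorphic chart with E =
(σ₁, σ₁). A form A with values in Λ ∧ Λ^(1) is σ ∧ θ with θ tangential, so it is encoded by the
bilinear form b(X, Y) = (θ_X, d_Y σ) (`bil`). Since 𝓝 is skew, kills σ and sends a tangent vector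
σ_w to the S^⊥-part of the derivative of σ_w, one finds on the coordinate frame dA = E⁻¹ tr(b) σ₁ ∧
σ₂ + σ ∧ dθ and [𝓝 ∧ A] = σ ∧ (1 - π_S) dθ (`ext_eq`, `bracket_eq`).

Hence d^𝓓 A = 0 says that tr b = 0 and π_S dθ ∈ Λ. Pairing dθ with σ gives the symmetry of b, and
pairing it with σ₁, σ₂ gives the Cauchy-Riemann equations: b is the real part of a holomorphic
quadratic differential (`quadAt_iff`). If moreover dA = 0, then dθ ∈ Λ, so [𝓝 ∧ A] = 0. Thus closed
means 𝓓-closed together with [𝓝 ∧ A] = 0 (`of_ext_eq_zero`).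

The Hodge star multiplies the quadratic differential by -i, so it preserves 𝓓-closedness. It also
satisfies [q ∧ *𝓝] = -[𝓝 ∧ *q] and [*η ∧ *𝓝] = [𝓝 ∧ η]. So the difference q of two multipliers has
*q closed, and *η may be added to a multiplier when η is closed.

It remains to see that closed forms are unique up to a real factor. The condition [𝓝 ∧ η] = 0 makes
the differential of η real-proportional to the Hopf differential wherever the latter is non-zero
(`bracket_relation`). Away from umbilics the quotient of two such differentials is therefore a
real-valued holomorphic function where the denominator does not vanish, hence locally constant, and
the identity theorem spreads the relation over the connected surface. A non-umbilic point exists: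
otherwise S is constant, and since n ≥ 3 the image would lie in a hypersphere
(`exists_not_umbilic`). -/

theorem lor_apply (u v : Mink n) : lor n u v = inner ℝ u.1 v.1 - u.2 * v.2 := rfl

theorem lor_comm (u v : Mink n) : lor n u v = lor n v u := by
  rw [lor_apply, lor_apply, real_inner_comm, mul_comm]

theorem wedge_apply (u v w : Mink n) : wedge u v w = lor n u w • v - lor n v w • u := rfl

/-- The Lorentzian metric as a continuous bilinear map. -/
def lorL (n : ℕ) : Mink n →L[ℝ] Mink n →L[ℝ] ℝ := (lor n).toContinuousBilinearMap

/-- The wedge product as a continuous bilinear map. -/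
def wedgeL (n : ℕ) : Mink n →L[ℝ] Mink n →L[ℝ] MinkEnd n :=
  (LinearMap.mk₂ ℝ (fun u v : Mink n => wedge u v)
    (fun u u' v => by refine ContinuousLinearMap.ext fun w => ?_; simp [wedge_apply, add_smul]; abel)
    (fun c u v => by refine ContinuousLinearMap.ext fun w => ?_; simp [wedge_apply, smul_sub, smul_smul, mul_comm])
    (fun v u u' => by refine ContinuousLinearMap.ext fun w => ?_; simp [wedge_apply, add_smul]; abel)
    (fun c u v => by
      refine ContinuousLinearMap.ext fun w => ?_; simp [wedge_apply, smul_sub, smul_smul, mul_comm])).toContinuousBilinearMap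

theorem wedge_add_right (u v w : Mink n) : wedge u (v + w) = wedge u v + wedge u w :=
  (wedgeL n u).map_add v w

theorem wedge_sub_right (u v w : Mink n) : wedge u (v - w) = wedge u v - wedge u w :=
  (wedgeL n u).map_sub v w

theorem wedge_smul_right (u : Mink n) (c : ℝ) (v : Mink n) : wedge u (c • v) = c • wedge u v :=
  (wedgeL n u).map_smul c v

theorem wedge_smul_left (c : ℝ) (u v : Mink n) : wedge (c • u) v = c • wedge u v := by
  have := congrArg (fun T : Mink n →L[ℝ] MinkEnd n => T v) ((wedgeL n).map_smul c u)
  exact this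

@[simp] theorem wedge_self (u : Mink n) : wedge u u = 0 := by
  refine ContinuousLinearMap.ext fun w => ?_; simp [wedge_apply]

theorem wedge_swap (u v : Mink n) : wedge u v = - wedge v u := by
  refine ContinuousLinearMap.ext fun w => ?_; simp [wedge_apply]

@[simp] theorem wedge_zero_right (u : Mink n) : wedge u 0 = 0 := (wedgeL n u).map_zero

/-- A skew endomorphism acts on `u ∧ v` as a derivation. -/
theorem lie_wedge {N : MinkEnd n} (hN : ∀ u v, lor n (N u) v = - lor n u (N v)) (u v : Mink n) :
    ⁅N, wedge u v⁆ = wedge (N u) v + wedge u (N v) := by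
  refine ContinuousLinearMap.ext fun w => ?_
  have h1 := hN u w
  have h2 := hN v w
  rw [Ring.lie_def]
  have h3 : (N * wedge u v) w = N (wedge u v w) := rfl
  have h4 : (wedge u v * N) w = wedge u v (N w) := rfl
  simp only [sub_apply, add_apply, h3, h4, wedge_apply, map_sub, map_smul, h1, h2, neg_smul]
  abel

/-! ### Directional derivatives of functions on the complex plane -/

section PD

variable {F : Type*} [NormedAddCommGroup F] [NormedSpace ℝ F]
  {G : Type*} [NormedAddCommGroup G] [NormedSpace ℝ G]
  {H : Type*} [NormedAddCommGroup H] [NormedSpace ℝ H]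

/-- The derivative of `f` in the direction `v`. -/
def pd (v : ℂ) (f : ℂ → F) (z : ℂ) : F := fderiv ℝ f z v

theorem pd_bilin (B : F →L[ℝ] G →L[ℝ] H) {f : ℂ → F} {g : ℂ → G} {z : ℂ}
    (hf : DifferentiableAt ℝ f z) (hg : DifferentiableAt ℝ g z) (v : ℂ) :
    pd v (fun w => B (f w) (g w)) z = B (pd v f z) (g z) + B (f z) (pd v g z) := by
  unfold pd
  rw [B.fderiv_of_bilinear hf hg]
  simp [ContinuousLinearMap.precompR, ContinuousLinearMap.precompL]
  abel

theorem pd_add {f g : ℂ → F} {z : ℂ} (hf : DifferentiableAt ℝ f z) (hg : DifferentiableAt ℝ g z)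
    (v : ℂ) : pd v (fun w => f w + g w) z = pd v f z + pd v g z := by
  unfold pd
  rw [fderiv_fun_add hf hg]; rfl

theorem pd_smul {c : ℂ → ℝ} {f : ℂ → F} {z : ℂ} (hc : DifferentiableAt ℝ c z)
    (hf : DifferentiableAt ℝ f z) (v : ℂ) :
    pd v (fun w => c w • f w) z = pd v c z • f z + c z • pd v f z :=
  pd_bilin (ContinuousLinearMap.lsmul ℝ ℝ) hc hf v

theorem pd_clm (T : F →L[ℝ] G) {f : ℂ → F} {z : ℂ} (hf : DifferentiableAt ℝ f z) (v : ℂ) :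
    pd v (fun w => T (f w)) z = T (pd v f z) := by
  unfold pd
  have := (T.hasFDerivAt.comp z hf.hasFDerivAt).fderiv
  exact (congrArg (fun L : ℂ →L[ℝ] G => L v) this)

theorem pd_apply {T : ℂ → F →L[ℝ] G} {f : ℂ → F} {z : ℂ} (hT : DifferentiableAt ℝ T z)
    (hf : DifferentiableAt ℝ f z) (v : ℂ) :
    pd v (fun w => T w (f w)) z = pd v T z (f z) + T z (pd v f z) :=
  pd_bilin (ContinuousLinearMap.id ℝ (F →L[ℝ] G)) hT hf v

theorem pd_congr {f g : ℂ → F} {U : Set ℂ} (hU : IsOpen U) {z : ℂ} (hz : z ∈ U)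
    (h : ∀ w ∈ U, f w = g w) (v : ℂ) : pd v f z = pd v g z := by
  unfold pd
  rw [Filter.EventuallyEq.fderiv_eq (Filter.eventuallyEq_of_mem (hU.mem_nhds hz) h)]

@[simp] theorem pd_const (v : ℂ) (c : F) (z : ℂ) : pd v (fun _ => c) z = 0 := by simp [pd]

theorem contDiffOn_bilin (B : F →L[ℝ] G →L[ℝ] H) {f : ℂ → F} {g : ℂ → G} {U : Set ℂ}
    (hf : ContDiffOn ℝ ∞ f U) (hg : ContDiffOn ℝ ∞ g U) :
    ContDiffOn ℝ ∞ (fun w => B (f w) (g w)) U :=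
  (B.contDiff.comp_contDiffOn hf).clm_apply hg

theorem _root_.ContDiffOn.pd {f : ℂ → F} {U : Set ℂ} (hf : ContDiffOn ℝ ∞ f U) (hU : IsOpen U)
    (v : ℂ) : ContDiffOn ℝ ∞ (pd v f) U :=
  (hf.fderiv_of_isOpen hU (m := ∞) (by simp)).clm_apply contDiffOn_const

theorem _root_.ContDiffOn.diffAt {f : ℂ → F} {U : Set ℂ} (hf : ContDiffOn ℝ ∞ f U) (hU : IsOpen U)
    {z : ℂ} (hz : z ∈ U) : DifferentiableAt ℝ f z :=
  (hf.contDiffAt (hU.mem_nhds hz)).differentiableAt (by simp)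

theorem pd_pd {f : ℂ → F} {U : Set ℂ} (hf : ContDiffOn ℝ ∞ f U) (hU : IsOpen U)
    {z : ℂ} (hz : z ∈ U) (v w : ℂ) : pd v (pd w f) z = fderiv ℝ (fderiv ℝ f) z v w := by
  have h := (hf.fderiv_of_isOpen hU (m := ∞) (by simp)).diffAt hU hz
  have := pd_apply h (differentiableAt_const w) v
  rw [pd_const, map_zero, add_zero] at this
  exact this

theorem two_le_infty : (2 : WithTop ℕ∞) ≤ ∞ :=
  WithTop.coe_le_coe.2 (le_top : (2 : ℕ∞) ≤ ⊤)

theorem pd_comm {f : ℂ → F} {U : Set ℂ} (hf : ContDiffOn ℝ ∞ f U) (hU : IsOpen U)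
    {z : ℂ} (hz : z ∈ U) (v w : ℂ) : pd v (pd w f) z = pd w (pd v f) z := by
  rw [pd_pd hf hU hz, pd_pd hf hU hz]
  exact ((hf.contDiffAt (hU.mem_nhds hz)).isSymmSndFDerivAt (by simpa using two_le_infty)).eq v w

theorem pd_dir_eq (f : ℂ → F) (z v : ℂ) : pd v f z = v.re • pd 1 f z + v.im • pd Complex.I f z := by
  unfold pd
  rw [← map_smul, ← map_smul, ← map_add]
  congr 1
  simp [Complex.re_add_im]

end PD

end

section

variable {n : ℕ}

/-! ### Orthogonal projection onto a sphere given by a frame -/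

/-- The relations satisfied by `σ, σ₁, σ₂, Δσ` for a normalised lift in a conformal chart. -/
structure IsFrame (a b c d : Mink n) : Prop where
  aa : lor n a a = 0
  ab : lor n a b = 0
  ac : lor n a c = 0
  ad : lor n a d = -2 * lor n b b
  bc : lor n b c = 0
  bd : lor n b d = 0
  cc : lor n c c = lor n b b
  cd : lor n c d = 0
  pos : 0 < lor n b b

/-- The rank one map `w ↦ (u, w) v`, depending bilinearly on `u` and `v`. -/
def rankOne (n : ℕ) : Mink n →L[ℝ] Mink n →L[ℝ] MinkEnd n :=
  (ContinuousLinearMap.smulRightL ℝ (Mink n) (Mink n)).comp (lorL n)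

/-- The orthogonal projection onto the span of a frame. -/
def frameProj (a b c d : Mink n) : MinkEnd n :=
  -- The coefficients form the inverse Gram matrix. The pair a, d has Gram matrix with entries 0,
  -- -2(b, b), (d, d), and is orthogonal to the conformal pair b, c.
  (-(2 * lor n b b)⁻¹) • (rankOne n d a + rankOne n a d)
    - (lor n d d * ((2 * lor n b b) ^ 2)⁻¹) • rankOne n a a
    + (lor n b b)⁻¹ • (rankOne n b b + rankOne n c c)

theorem frameProj_apply (a b c d v : Mink n) : frameProj a b c d v =
    (-(2 * lor n b b)⁻¹) • (lor n d v • a + lor n a v • d)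
      - (lor n d d * ((2 * lor n b b) ^ 2)⁻¹) • lor n a v • a
      + (lor n b b)⁻¹ • (lor n b v • b + lor n c v • c) := rfl

theorem lor_frameProj (a b c d v w : Mink n) :
    lor n (frameProj a b c d v) w = lor n v (frameProj a b c d w) := by
  simp only [frameProj_apply, map_add, map_sub, map_smul, smul_eq_mul, LinearMap.add_apply,
    LinearMap.sub_apply, LinearMap.smul_apply, lor_comm v]
  ring

theorem frameProj_mem (a b c d v : Mink n) :
    frameProj a b c d v ∈ Submodule.span ℝ {a, b, c, d} := by
  have ha : a ∈ Submodule.span ℝ {a, b, c, d} := Submodule.subset_span (by simp)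
  have hb : b ∈ Submodule.span ℝ {a, b, c, d} := Submodule.subset_span (by simp)
  have hc : c ∈ Submodule.span ℝ {a, b, c, d} := Submodule.subset_span (by simp)
  have hd : d ∈ Submodule.span ℝ {a, b, c, d} := Submodule.subset_span (by simp)
  rw [frameProj_apply]
  refine add_mem (sub_mem (Submodule.smul_mem _ _ (add_mem ?_ ?_)) (Submodule.smul_mem _ _ ?_))
    (Submodule.smul_mem _ _ (add_mem ?_ ?_))
  all_goals exact Submodule.smul_mem _ _ (by assumption)

namespace IsFrame

variable {a b c d : Mink n} (h : IsFrame a b c d)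
include h

theorem proj_a : frameProj a b c d a = a := by
  have hp := h.pos.ne'
  have e1 := lor_comm d a
  have e2 := lor_comm b a
  have e3 := lor_comm c a
  rw [frameProj_apply, e1, e2, e3, h.aa, h.ab, h.ac, h.ad]
  simp only [zero_smul, smul_zero, add_zero, sub_zero, smul_smul]
  rw [show -(2 * lor n b b)⁻¹ * (-2 * lor n b b) = 1 by field_simp, one_smul]

theorem proj_b : frameProj a b c d b = b := by
  have hp := h.pos.ne'
  have e1 := lor_comm d b
  have e3 := lor_comm c b
  rw [frameProj_apply, e1, e3, h.ab, h.bd, h.bc]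
  simp only [zero_smul, smul_zero, add_zero, sub_zero, smul_smul, zero_add]
  rw [inv_mul_cancel₀ hp, one_smul]

theorem proj_c : frameProj a b c d c = c := by
  have hp := h.pos.ne'
  have e1 := lor_comm d c
  rw [frameProj_apply, e1, h.ac, h.cd, h.bc, h.cc]
  simp only [zero_smul, smul_zero, add_zero, sub_zero, smul_smul, zero_add]
  rw [inv_mul_cancel₀ hp, one_smul]

theorem proj_d : frameProj a b c d d = d := by
  have hp := h.pos.ne'
  rw [frameProj_apply, h.ad, h.bd, h.cd]
  simp only [zero_smul, smul_zero, add_zero, smul_smul, smul_add]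
  rw [show -(2 * lor n b b)⁻¹ * (-2 * lor n b b) = 1 by field_simp, one_smul,
    show lor n d d * ((2 * lor n b b) ^ 2)⁻¹ * (-2 * lor n b b) = -(2 * lor n b b)⁻¹ * lor n d d by
      field_simp]
  abel

theorem proj_of_mem {v : Mink n} (hv : v ∈ Submodule.span ℝ {a, b, c, d}) :
    frameProj a b c d v = v := by
  induction hv using Submodule.span_induction with
  | mem x hx =>
    rcases hx with rfl | rfl | rfl | rfl
    exacts [h.proj_a, h.proj_b, h.proj_c, h.proj_d]
  | zero => simp
  | add x y _ _ hx hy => rw [map_add, hx, hy]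
  | smul t x _ hx => rw [map_smul, hx]

theorem proj_proj (v : Mink n) : frameProj a b c d (frameProj a b c d v) = frameProj a b c d v :=
  h.proj_of_mem (frameProj_mem _ _ _ _ _)

/-- Inside the span, the orthogonal of ⟨a, b, c⟩ is ⟨a⟩, because a is null and orthogonal to b and
c. Applied to dθ, this turns π_S dθ ∈ Λ into three scalar equations. -/
theorem proj_eq_smul_iff (v : Mink n) : (∃ t : ℝ, frameProj a b c d v = t • a) ↔
    lor n a v = 0 ∧ lor n b v = 0 ∧ lor n c v = 0 := by
  have hp := h.pos.ne'
  constructor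
  · rintro ⟨t, ht⟩
    have key : ∀ w, frameProj a b c d w = w → lor n a w = 0 → lor n w v = 0 := by
      intro w hw haw
      rw [← hw, lor_frameProj, ht, map_smul, lor_comm, haw, smul_zero]
    exact ⟨key a h.proj_a h.aa, key b h.proj_b h.ab, key c h.proj_c h.ac⟩
  · rintro ⟨h1, h2, h3⟩
    refine ⟨-(2 * lor n b b)⁻¹ * lor n d v, ?_⟩
    rw [frameProj_apply, h1, h2, h3]
    simp only [zero_smul, smul_zero, add_zero, sub_zero, smul_smul]

/-- `orthProj` branches on non-degeneracy. The explicit projection settles the branch, since v - Pv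
is orthogonal to the span, and it also gives the value. -/
theorem orthProj_span : orthProj (Submodule.span ℝ {a, b, c, d}) = frameProj a b c d := by
  set W := Submodule.span ℝ {a, b, c, d} with hW
  have hmem : ∀ v, frameProj a b c d v ∈ W := frameProj_mem a b c d
  have horth : ∀ v, v - frameProj a b c d v ∈ (lor n).orthogonal W := by
    intro v
    rw [LinearMap.BilinForm.mem_orthogonal_iff]
    intro w hw
    change lor n w _ = 0
    rw [map_sub, ← lor_frameProj, h.proj_of_mem hw, sub_self]
  have hc : IsCompl W ((lor n).orthogonal W) := by
    constructor
    · rw [Submodule.disjoint_def]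
      intro w hw hw'
      rw [LinearMap.BilinForm.mem_orthogonal_iff] at hw'
      have key : ∀ u ∈ ({a, b, c, d} : Set (Mink n)), lor n u w = 0 := fun u hu =>
        hw' u (Submodule.subset_span hu)
      rw [← h.proj_of_mem hw, frameProj_apply, key a (by simp), key b (by simp), key c (by simp),
        key d (by simp)]
      simp
    · rw [codisjoint_iff, eq_top_iff]
      intro v _
      rw [← add_sub_cancel (frameProj a b c d v) v]
      exact Submodule.add_mem_sup (hmem v) (horth v)
  unfold orthProj
  rw [dif_pos hc]
  refine ContinuousLinearMap.ext fun v => ?_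
  change Submodule.projection W _ hc v = _
  have e : v = frameProj a b c d v + (v - frameProj a b c d v) := by abel
  conv_lhs => rw [e]
  rw [map_add, Submodule.projection_apply_left hc ⟨_, hmem v⟩,
    Submodule.projection_apply_right hc ⟨_, horth v⟩, add_zero]

end IsFrame

end

section

variable {n : ℕ}

/-! ### Normalised lifts in a conformal chart -/

/-- `s` is the expression, on an open subset `U` of the plane, of a lift of a conformal immersion,
normalised by `s.2 = 1`. -/
structure ConfPatch (s : ℂ → Mink n) (U : Set ℂ) : Prop where
  isOpen : IsOpen U
  smooth : ContDiffOn ℝ ∞ s U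
  snd_eq : ∀ z ∈ U, (s z).2 = 1
  null : ∀ z ∈ U, lor n (s z) (s z) = 0
  conf : ∀ z ∈ U, lor n (pd Complex.I s z) (pd Complex.I s z) = lor n (pd 1 s z) (pd 1 s z)
  orth : ∀ z ∈ U, lor n (pd 1 s z) (pd Complex.I s z) = 0
  pos : ∀ z ∈ U, 0 < lor n (pd 1 s z) (pd 1 s z)

/-- The Laplacian in terms of directional derivatives. -/
def lap (s : ℂ → Mink n) (z : ℂ) : Mink n :=
  pd 1 (pd 1 s) z + pd Complex.I (pd Complex.I s) z

/-- The projection onto the central sphere congruence. -/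
def patchProj (s : ℂ → Mink n) (z : ℂ) : MinkEnd n :=
  frameProj (s z) (pd 1 s z) (pd Complex.I s z) (lap s z)

theorem pd_lor {f g : ℂ → Mink n} {z : ℂ} (hf : DifferentiableAt ℝ f z)
    (hg : DifferentiableAt ℝ g z) (v : ℂ) :
    pd v (fun w => lor n (f w) (g w)) z = lor n (pd v f z) (g z) + lor n (f z) (pd v g z) :=
  pd_bilin (lorL n) hf hg v

theorem pd_wedge {f g : ℂ → Mink n} {z : ℂ} (hf : DifferentiableAt ℝ f z)
    (hg : DifferentiableAt ℝ g z) (v : ℂ) :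
    pd v (fun w => wedge (f w) (g w)) z = wedge (pd v f z) (g z) + wedge (f z) (pd v g z) :=
  pd_bilin (wedgeL n) hf hg v

theorem pd_snd {f : ℂ → Mink n} {z : ℂ} (hf : DifferentiableAt ℝ f z) (v : ℂ) :
    pd v (fun w => (f w).2) z = (pd v f z).2 :=
  pd_clm (ContinuousLinearMap.snd ℝ (EuclideanSpace ℝ (Fin (n + 1))) ℝ) hf v

theorem _root_.ContDiffOn.lor {f g : ℂ → Mink n} {U : Set ℂ} (hf : ContDiffOn ℝ ∞ f U) (hg : ContDiffOn ℝ ∞ g U) :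
    ContDiffOn ℝ ∞ (fun w => lor n (f w) (g w)) U :=
  contDiffOn_bilin (lorL n) hf hg

theorem _root_.ContDiffOn.rankOne {f g : ℂ → Mink n} {U : Set ℂ} (hf : ContDiffOn ℝ ∞ f U) (hg : ContDiffOn ℝ ∞ g U) :
    ContDiffOn ℝ ∞ (fun w => rankOne n (f w) (g w)) U :=
  contDiffOn_bilin (CWSurface.rankOne n) hf hg

theorem lor_deriv {U : Set ℂ} {z : ℂ} (hU : IsOpen U) {f g : ℂ → Mink n} (hf : ContDiffOn ℝ ∞ f U)
    (hg : ContDiffOn ℝ ∞ g U) {c : ℝ} (hc : ∀ w ∈ U, lor n (f w) (g w) = c) (hz : z ∈ U) (v : ℂ) :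
    lor n (pd v f z) (g z) + lor n (f z) (pd v g z) = 0 := by
  rw [← pd_lor (hf.diffAt hU hz) (hg.diffAt hU hz), pd_congr hU hz hc, pd_const]

namespace ConfPatch

variable {s : ℂ → Mink n} {U : Set ℂ} (h : ConfPatch s U) {z : ℂ} (hz : z ∈ U)
include h

theorem smooth_pd (v : ℂ) : ContDiffOn ℝ ∞ (pd v s) U := h.smooth.pd h.isOpen v

theorem smooth_pd_pd (v w : ℂ) : ContDiffOn ℝ ∞ (pd v (pd w s)) U :=
  (h.smooth_pd w).pd h.isOpen v

theorem smooth_lap : ContDiffOn ℝ ∞ (lap s) U := (h.smooth_pd_pd _ _).add (h.smooth_pd_pd _ _)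

theorem smooth_energy_inv :
    ContDiffOn ℝ ∞ (fun w => (lor n (pd 1 s w) (pd 1 s w))⁻¹) U :=
  (ContDiffOn.lor (h.smooth_pd 1) (h.smooth_pd 1)).inv fun w hw => (h.pos w hw).ne'

theorem smooth_patchProj : ContDiffOn ℝ ∞ (patchProj s) U := by
  have hE := ContDiffOn.lor (h.smooth_pd 1) (h.smooth_pd 1)
  have h2E : ContDiffOn ℝ ∞ (fun w => 2 * lor n (pd 1 s w) (pd 1 s w)) U :=
    contDiffOn_const.mul hE
  have h2 : ContDiffOn ℝ ∞ (fun w => (2 * lor n (pd 1 s w) (pd 1 s w))⁻¹) U :=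
    h2E.inv fun w hw => (mul_pos two_pos (h.pos w hw)).ne'
  have h3 : ContDiffOn ℝ ∞ (fun w => ((2 * lor n (pd 1 s w) (pd 1 s w)) ^ 2)⁻¹) U :=
    (h2E.pow 2).inv fun w hw => (pow_pos (mul_pos two_pos (h.pos w hw)) 2).ne'
  refine ((h2.neg.smul ((ContDiffOn.rankOne h.smooth_lap h.smooth).add
    (ContDiffOn.rankOne h.smooth h.smooth_lap))).sub
    (((ContDiffOn.lor h.smooth_lap h.smooth_lap).mul h3).smul
      (ContDiffOn.rankOne h.smooth h.smooth))).add
    (h.smooth_energy_inv.smul ((ContDiffOn.rankOne (h.smooth_pd 1) (h.smooth_pd 1)).add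
      (ContDiffOn.rankOne (h.smooth_pd Complex.I) (h.smooth_pd Complex.I))))

include hz

theorem diffAt : DifferentiableAt ℝ s z := h.smooth.diffAt h.isOpen hz

theorem diffAt_pd (v : ℂ) : DifferentiableAt ℝ (pd v s) z := (h.smooth_pd v).diffAt h.isOpen hz

theorem snd_pd (v : ℂ) : (pd v s z).2 = 0 := by
  rw [← pd_snd (h.diffAt hz), pd_congr h.isOpen hz h.snd_eq, pd_const]

theorem lor_s_pd (v : ℂ) : lor n (s z) (pd v s z) = 0 := by
  have := lor_deriv h.isOpen h.smooth h.smooth h.null hz v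
  rw [lor_comm (pd v s z)] at this
  linarith

theorem lor_s_pd_pd (v w : ℂ) :
    lor n (s z) (pd w (pd v s) z) = - lor n (pd w s z) (pd v s z) := by
  have := lor_deriv h.isOpen h.smooth (h.smooth_pd v) (fun u hu => h.lor_s_pd hu v) hz w
  linarith

theorem pd_conf (v : ℂ) : lor n (pd Complex.I s z) (pd v (pd Complex.I s) z) =
    lor n (pd 1 s z) (pd v (pd 1 s) z) := by
  have := pd_congr h.isOpen hz h.conf v
  rw [pd_lor (h.diffAt_pd hz _) (h.diffAt_pd hz _), pd_lor (h.diffAt_pd hz _) (h.diffAt_pd hz _),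
    lor_comm (pd v (pd Complex.I s) z), lor_comm (pd v (pd 1 s) z)] at this
  linarith

theorem pd_orth (v : ℂ) : lor n (pd Complex.I s z) (pd v (pd 1 s) z) =
    - lor n (pd 1 s z) (pd v (pd Complex.I s) z) := by
  have := lor_deriv h.isOpen (h.smooth_pd _) (h.smooth_pd _) h.orth hz v
  rw [lor_comm] at this
  linarith

theorem pd_comm' (v w : ℂ) : pd v (pd w s) z = pd w (pd v s) z := pd_comm h.smooth h.isOpen hz v w

/-- Differentiating (σ, σ_i) = 0 gives (σ, Δσ) = -2(σ₁, σ₁). Differentiating the two conformality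
relations shows that Δσ is orthogonal to σ₁ and σ₂. -/
theorem isFrame : IsFrame (s z) (pd 1 s z) (pd Complex.I s z) (lap s z) where
  aa := h.null z hz
  ab := h.lor_s_pd hz 1
  ac := h.lor_s_pd hz Complex.I
  ad := by
    rw [lap, map_add, h.lor_s_pd_pd hz, h.lor_s_pd_pd hz, h.conf z hz]; ring
  bc := h.orth z hz
  bd := by
    have e1 := h.pd_orth hz Complex.I
    rw [h.pd_comm' hz, h.pd_conf hz] at e1
    rw [lap, map_add]; linarith
  cc := h.conf z hz
  cd := by
    rw [lap, map_add, h.pd_orth hz, h.pd_comm' hz 1, h.pd_conf hz]; ring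
  pos := h.pos z hz

theorem diffAt_patchProj : DifferentiableAt ℝ (patchProj s) z :=
  h.smooth_patchProj.diffAt h.isOpen hz

theorem patchProj_s : patchProj s z (s z) = s z := (h.isFrame hz).proj_a

theorem patchProj_pd (v : ℂ) : patchProj s z (pd v s z) = pd v s z := by
  rw [pd_dir_eq, map_add, map_smul, map_smul, patchProj, (h.isFrame hz).proj_b,
    (h.isFrame hz).proj_c]

theorem patchProj_lap : patchProj s z (lap s z) = lap s z := (h.isFrame hz).proj_d

/-- The derivative of the projection on a section of the central sphere congruence. -/
theorem pd_patchProj_apply {f : ℂ → Mink n} (hf : ContDiffOn ℝ ∞ f U)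
    (hPf : ∀ w ∈ U, patchProj s w (f w) = f w) (v : ℂ) :
    pd v (patchProj s) z (f z) = pd v f z - patchProj s z (pd v f z) := by
  have := pd_congr h.isOpen hz hPf v
  rw [pd_apply (h.diffAt_patchProj hz) (hf.diffAt h.isOpen hz)] at this
  exact eq_sub_of_add_eq this

theorem pd_patchProj_s (v : ℂ) : pd v (patchProj s) z (s z) = 0 := by
  rw [h.pd_patchProj_apply hz h.smooth (fun w hw => h.patchProj_s hw), h.patchProj_pd hz, sub_self]

theorem pd_patchProj_pd (v w : ℂ) : pd v (patchProj s) z (pd w s z) =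
    pd v (pd w s) z - patchProj s z (pd v (pd w s) z) :=
  h.pd_patchProj_apply hz (h.smooth_pd w) (fun _ hu => h.patchProj_pd hu w) v

theorem lor_pd_patchProj (v : ℂ) (x y : Mink n) :
    lor n (pd v (patchProj s) z x) y = lor n x (pd v (patchProj s) z y) := by
  have hP := h.diffAt_patchProj hz
  have e1 := pd_lor (hP.clm_apply (differentiableAt_const x)) (differentiableAt_const y) v
  have e2 := pd_lor (differentiableAt_const x) (hP.clm_apply (differentiableAt_const y)) v
  rw [pd_apply hP (differentiableAt_const _)] at e1 e2
  simp only [pd_const, map_zero, add_zero, zero_add, LinearMap.zero_apply] at e1 e2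
  rw [← e1, ← e2]
  exact congrArg (fun f => pd v f z) (funext fun w => lor_frameProj _ _ _ _ _ _)

/-- This is the derivative of P² = P. -/
theorem pd_patchProj_eq (v : ℂ) (x : Mink n) : pd v (patchProj s) z x =
    pd v (patchProj s) z (patchProj s z x) + patchProj s z (pd v (patchProj s) z x) := by
  have hP := h.diffAt_patchProj hz
  have e := pd_congr h.isOpen hz (f := fun w => patchProj s w (patchProj s w x))
    (g := fun w => patchProj s w x) (fun w hw => (h.isFrame hw).proj_proj x) v
  rw [pd_apply hP (hP.clm_apply (differentiableAt_const x)),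
    pd_apply hP (differentiableAt_const _)] at e
  simp only [pd_const, map_zero, add_zero] at e
  exact e.symm

end ConfPatch

/-- The tensor `𝓝` in a chart. -/
def patchN (s : ℂ → Mink n) (z v : ℂ) : MinkEnd n :=
  (sandwich (1 - patchProj s z) (patchProj s z) - sandwich (patchProj s z) (1 - patchProj s z))
    (pd v (patchProj s) z)

theorem patchN_apply (s : ℂ → Mink n) (z v : ℂ) (x : Mink n) : patchN s z v x =
    (pd v (patchProj s) z (patchProj s z x)
      - patchProj s z (pd v (patchProj s) z (patchProj s z x)))
    - patchProj s z (pd v (patchProj s) z (x - patchProj s z x)) := rfl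

namespace ConfPatch

variable {s : ℂ → Mink n} {U : Set ℂ} (h : ConfPatch s U) {z : ℂ} (hz : z ∈ U)
include h hz

/-- P and its derivative are self-adjoint, so taking adjoints exchanges the two terms of 𝓝, which
carry opposite signs. -/
theorem lor_patchN (v : ℂ) (x y : Mink n) :
    lor n (patchN s z v x) y = - lor n x (patchN s z v y) := by
  have hP : ∀ x y, lor n (patchProj s z x) y = lor n x (patchProj s z y) :=
    fun x y => lor_frameProj _ _ _ _ x y
  have hD := h.lor_pd_patchProj hz v
  simp only [patchN_apply, map_sub, LinearMap.sub_apply, hP, hD]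
  ring

theorem patchN_s (v : ℂ) : patchN s z v (s z) = 0 := by
  rw [patchN_apply, h.patchProj_s hz, h.pd_patchProj_s hz]; simp

theorem patchN_pd (v w : ℂ) : patchN s z v (pd w s z) =
    pd v (pd w s) z - patchProj s z (pd v (pd w s) z) := by
  have e : patchProj s z (patchProj s z (pd v (pd w s) z)) = patchProj s z (pd v (pd w s) z) :=
    (h.isFrame hz).proj_proj _
  rw [patchN_apply, h.patchProj_pd hz, h.pd_patchProj_pd hz, map_sub (patchProj s z), e]
  simp

/-- If all `(1 - π_S) σ_{ij}` vanish, the central sphere congruence is constant. -/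
theorem pd_patchProj_eq_zero
    (h11 : ∀ w ∈ U, patchProj s w (pd 1 (pd 1 s) w) = pd 1 (pd 1 s) w)
    (h12 : ∀ w ∈ U, patchProj s w (pd 1 (pd Complex.I s) w) = pd 1 (pd Complex.I s) w) (v : ℂ) :
    pd v (patchProj s) z = 0 := by
  have h21 : ∀ w ∈ U, pd Complex.I (pd 1 s) w = pd 1 (pd Complex.I s) w := fun w hw =>
    h.pd_comm' hw _ _
  have h22 : ∀ w ∈ U, patchProj s w (pd Complex.I (pd Complex.I s) w) =
      pd Complex.I (pd Complex.I s) w := by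
    intro w hw
    have e := h.patchProj_lap hw
    rw [lap, map_add, h11 w hw] at e
    exact add_left_cancel e
  set D := fun v => pd v (patchProj s) z with hD
  have hDs : ∀ v, D v (s z) = 0 := h.pd_patchProj_s hz
  have hall : ∀ v w : ℂ, v = 1 ∨ v = Complex.I → w = 1 ∨ w = Complex.I →
      patchProj s z (pd v (pd w s) z) = pd v (pd w s) z := by
    rintro v w (rfl | rfl) (rfl | rfl)
    exacts [h11 z hz, h12 z hz, by rw [h21 z hz, h12 z hz], h22 z hz]
  have hDd : ∀ v w : ℂ, v = 1 ∨ v = Complex.I → w = 1 ∨ w = Complex.I →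
      D v (pd w s z) = 0 := fun v w hv hw => by
    rw [hD]; dsimp only; rw [h.pd_patchProj_pd hz, hall v w hv hw, sub_self]
  have s12 := h.smooth_pd_pd 1 Complex.I
  -- On sections of S, D is the S^⊥-part of the derivative, so `c1` and `c2` are the symmetry of the
  -- third derivatives of s.
  have c1 : D Complex.I (pd 1 (pd 1 s) z) = D 1 (pd 1 (pd Complex.I s) z) := by
    rw [hD]; dsimp only
    rw [h.pd_patchProj_apply hz (h.smooth_pd_pd 1 1) h11, h.pd_patchProj_apply hz s12 h12,
      pd_comm (h.smooth_pd 1) h.isOpen hz Complex.I 1, pd_congr h.isOpen hz h21]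
  have c2 : D 1 (pd Complex.I (pd Complex.I s) z) = D Complex.I (pd 1 (pd Complex.I s) z) := by
    rw [hD]; dsimp only
    rw [h.pd_patchProj_apply hz (h.smooth_pd_pd _ _) h22, h.pd_patchProj_apply hz s12 h12,
      pd_comm (h.smooth_pd Complex.I) h.isOpen hz 1 Complex.I]
  -- A vector of S orthogonal to s has no component along Δs, so D kills it. This applies to s₁₂ and
  -- to s₁₁ - s₂₂; with `c1` and `c2` it gives D(Δs) = 0.
  have tang : ∀ x : Mink n, patchProj s z x = x → lor n (s z) x = 0 →
      ∀ v, v = 1 ∨ v = Complex.I → D v x = 0 := by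
    intro x hx hsx v hv
    have e : x = (-(2 * lor n (pd 1 s z) (pd 1 s z))⁻¹ * lor n (lap s z) x) • s z
        + (lor n (pd 1 s z) (pd 1 s z))⁻¹ • (lor n (pd 1 s z) x • pd 1 s z
          + lor n (pd Complex.I s z) x • pd Complex.I s z) := by
      conv_lhs => rw [← hx, patchProj, frameProj_apply, hsx]
      simp only [zero_smul, smul_zero, add_zero, sub_zero, smul_smul]
    rw [e]
    simp only [map_add, map_smul, hDs, hDd v 1 hv (Or.inl rfl), hDd v Complex.I hv (Or.inr rfl),
      smul_zero, add_zero]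
  have z12 : ∀ v, v = 1 ∨ v = Complex.I → D v (pd 1 (pd Complex.I s) z) = 0 :=
    tang _ (h12 z hz) (by rw [h.lor_s_pd_pd hz, h.orth z hz, neg_zero])
  have zdiff : ∀ v, v = 1 ∨ v = Complex.I →
      D v (pd 1 (pd 1 s) z - pd Complex.I (pd Complex.I s) z) = 0 :=
    tang _ (by rw [map_sub, h11 z hz, h22 z hz]) (by
      rw [map_sub, h.lor_s_pd_pd hz, h.lor_s_pd_pd hz, h.conf z hz, sub_self])
  have hDlap : ∀ v, v = 1 ∨ v = Complex.I → D v (lap s z) = 0 := by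
    rintro v hv
    have e := zdiff v hv
    rw [map_sub, sub_eq_zero] at e
    rw [lap, map_add]
    rcases hv with rfl | rfl
    · rw [e, c2, z12 _ (Or.inr rfl), add_zero]
    · rw [← e, c1, z12 _ (Or.inl rfl), add_zero]
  have hPD : ∀ v, v = 1 ∨ v = Complex.I → D v = 0 := by
    intro v hv
    have hDP : ∀ x, D v (patchProj s z x) = 0 := by
      intro x
      have hx := frameProj_mem (s z) (pd 1 s z) (pd Complex.I s z) (lap s z) x
      change patchProj s z x ∈ _ at hx
      generalize patchProj s z x = y at hx
      induction hx using Submodule.span_induction with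
      | mem y hy =>
        rcases hy with rfl | rfl | rfl | rfl
        exacts [hDs v, hDd v 1 hv (Or.inl rfl), hDd v _ hv (Or.inr rfl), hDlap v hv]
      | zero => simp
      | add x y _ _ hx hy => rw [map_add, hx, hy, add_zero]
      | smul t x _ hx => rw [map_smul, hx, smul_zero]
    have nondeg : ∀ x : Mink n, (∀ y, lor n x y = 0) → x = 0 := by
      intro x hx
      have e1 := hx (x.1, 0)
      have e2 := hx (0, 1)
      simp only [lor_apply, mul_zero, sub_zero, inner_self_eq_zero, inner_zero_right, mul_one,
        zero_sub, neg_eq_zero] at e1 e2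
      exact Prod.ext e1 e2
    refine ContinuousLinearMap.ext fun x => nondeg _ fun y => ?_
    -- As D vanishes on S, the derivative of P² = P reads D = PD. Self-adjointness then gives (PDx,
    -- y) = (x, DPy) = 0.
    have e : D v x = patchProj s z (D v x) := by
      have := h.pd_patchProj_eq hz v x
      change D v x = D v _ + patchProj s z (D v x) at this
      rwa [hDP, zero_add] at this
    rw [e, patchProj, lor_frameProj]
    exact (h.lor_pd_patchProj hz v x _).trans (by rw [← patchProj]; rw [show pd v (patchProj s) z
      (patchProj s z y) = 0 from hDP y, map_zero])
  have := pd_dir_eq (patchProj s) z v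
  rw [this, show pd 1 (patchProj s) z = 0 from hPD 1 (Or.inl rfl),
    show pd Complex.I (patchProj s) z = 0 from hPD _ (Or.inr rfl)]
  simp

end ConfPatch

end

section

variable {n : ℕ}

theorem zero_smul_end (T : MinkEnd n) : (0 : ℝ) • T = 0 := zero_smul ℝ T

/-! ### Forms with values in `Λ ∧ Λ^{(1)}` in a conformal chart -/

/-- The trace-free part of the second fundamental form of the central sphere congruence. -/
def hess (s : ℂ → Mink n) (v w z : ℂ) : Mink n :=
  pd v (pd w s) z - patchProj s z (pd v (pd w s) z)

/-- The bilinear form `(X, Y) ↦ (θ_X, d_Y σ)` of `A = σ ∧ θ`, for a normalised lift `σ`. -/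
def bil (A : ℂ → ℂ →L[ℝ] MinkEnd n) (s : ℂ → Mink n) (v w z : ℂ) : ℝ :=
  -- The map σ ∧ θ_v sends σ_w to -(θ_v, σ_w) σ, and σ has last coordinate 1.
  -(A z v (pd w s z)).2

/-- The tangential representative `θ` in `A = σ ∧ θ`. -/
def tang (A : ℂ → ℂ →L[ℝ] MinkEnd n) (s : ℂ → Mink n) (v z : ℂ) : Mink n :=
  (lor n (pd 1 s z) (pd 1 s z))⁻¹ •
    (bil A s v 1 z • pd 1 s z + bil A s v Complex.I z • pd Complex.I s z)

/-- The form `dθ`, evaluated on the coordinate fields. -/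
def dtang (A : ℂ → ℂ →L[ℝ] MinkEnd n) (s : ℂ → Mink n) (z : ℂ) : Mink n :=
  pd 1 (tang A s Complex.I) z - pd Complex.I (tang A s 1) z

/-- `A` is, on `U`, a smooth form with values in `Λ ∧ Λ^{(1)}`. -/
structure PatchForm (A : ℂ → ℂ →L[ℝ] MinkEnd n) (s : ℂ → Mink n) (U : Set ℂ) : Prop where
  smooth : ContDiffOn ℝ ∞ A U
  mem : ∀ z ∈ U, ∀ v, ∃ t₁ t₂ : ℝ, A z v = wedge (s z) (t₁ • pd 1 s z + t₂ • pd Complex.I s z)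

/-- The bilinear form of `A` is the real part of a quadratic differential, whose coefficient
satisfies the Cauchy-Riemann equations at `z`. -/
structure QuadAt (A : ℂ → ℂ →L[ℝ] MinkEnd n) (s : ℂ → Mink n) (z : ℂ) : Prop where
  trace : bil A s Complex.I Complex.I z = - bil A s 1 1 z
  symm : bil A s 1 Complex.I z = bil A s Complex.I 1 z
  cr₁ : pd 1 (bil A s Complex.I 1) z = pd Complex.I (bil A s 1 1) z
  cr₂ : pd 1 (bil A s Complex.I Complex.I) z = pd Complex.I (bil A s 1 Complex.I) z

theorem lor_tang (A : ℂ → ℂ →L[ℝ] MinkEnd n) (s : ℂ → Mink n) (z : ℂ) (x : Mink n) (v : ℂ) : lor n x (tang A s v z) =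
    (lor n (pd 1 s z) (pd 1 s z))⁻¹ *
      (bil A s v 1 z * lor n (pd 1 s z) x + bil A s v Complex.I z * lor n (pd Complex.I s z) x) := by
  simp [tang, lor_comm x, mul_add]

namespace ConfPatch

variable {s : ℂ → Mink n} {U : Set ℂ} (h : ConfPatch s U) {A : ℂ → ℂ →L[ℝ] MinkEnd n}
include h

theorem smooth_bil (hA : PatchForm A s U) (v w : ℂ) : ContDiffOn ℝ ∞ (bil A s v w) U := by
  have e : ContDiffOn ℝ ∞ (fun z => A z v (pd w s z)) U :=
    contDiffOn_bilin (ContinuousLinearMap.id ℝ (MinkEnd n))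
      (hA.smooth.clm_apply contDiffOn_const) (h.smooth_pd w)
  exact ((ContinuousLinearMap.snd ℝ (EuclideanSpace ℝ (Fin (n + 1))) ℝ).contDiff.comp_contDiffOn
    e).neg

theorem smooth_tang (hA : PatchForm A s U) (v : ℂ) : ContDiffOn ℝ ∞ (tang A s v) U :=
  h.smooth_energy_inv.smul (((h.smooth_bil hA v 1).smul (h.smooth_pd 1)).add
    ((h.smooth_bil hA v Complex.I).smul (h.smooth_pd Complex.I)))

variable {z : ℂ} (hz : z ∈ U)
include hz

/-- A is recovered from its bilinear form: σ₁, σ₂ are orthogonal of equal length, so θ is expanded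
by its pairings with them. -/
theorem eq_wedge_tang (hA : PatchForm A s U) (v : ℂ) : A z v = wedge (s z) (tang A s v z) := by
  obtain ⟨t₁, t₂, ht⟩ := hA.mem z hz v
  have hp := (h.pos z hz).ne'
  have hb : ∀ w, bil A s v w z = lor n (t₁ • pd 1 s z + t₂ • pd Complex.I s z) (pd w s z) := by
    intro w
    rw [bil, ht, wedge_apply, h.lor_s_pd hz, zero_smul, zero_sub, Prod.snd_neg, Prod.smul_snd,
      h.snd_eq z hz, smul_eq_mul, mul_one, neg_neg]
  rw [ht, tang, hb, hb]
  congr 1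
  simp only [map_add, map_smul, LinearMap.add_apply, LinearMap.smul_apply, h.conf z hz,
    h.orth z hz, lor_comm (pd Complex.I s z) (pd 1 s z), smul_eq_mul, mul_zero, add_zero, zero_add,
    smul_add, smul_smul]
  congr 2 <;> field_simp

theorem lor_pd_tang (v w : ℂ) (hw : w = 1 ∨ w = Complex.I) :
    lor n (pd w s z) (tang A s v z) = bil A s v w z := by
  have hp := (h.pos z hz).ne'
  rcases hw with rfl | rfl <;>
  simp only [tang, map_add, map_smul, h.conf z hz, h.orth z hz,
    lor_comm (pd Complex.I s z) (pd 1 s z), smul_eq_mul, mul_zero, add_zero, zero_add] <;>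
  field_simp

theorem lor_s_tang (v : ℂ) : lor n (s z) (tang A s v z) = 0 := by
  simp [tang, h.lor_s_pd hz]

/-- The exterior derivative of `σ ∧ θ`. -/
theorem ext_eq (hA : PatchForm A s U) :
    pd 1 (fun w => A w Complex.I) z - pd Complex.I (fun w => A w 1) z =
      ((lor n (pd 1 s z) (pd 1 s z))⁻¹ * (bil A s 1 1 z + bil A s Complex.I Complex.I z)) •
        wedge (pd 1 s z) (pd Complex.I s z) + wedge (s z) (dtang A s z) := by
  have hθ : ∀ v, DifferentiableAt ℝ (tang A s v) z := fun v =>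
    (h.smooth_tang hA v).diffAt h.isOpen hz
  rw [pd_congr h.isOpen hz (fun w hw => h.eq_wedge_tang hw hA Complex.I),
    pd_congr h.isOpen hz (fun w hw => h.eq_wedge_tang hw hA 1),
    pd_wedge (h.diffAt hz) (hθ _), pd_wedge (h.diffAt hz) (hθ _), dtang, wedge_sub_right]
  refine ContinuousLinearMap.ext fun x => ?_
  simp only [add_apply, sub_apply, smul_apply, wedge_apply, tang, map_smul, map_add,
    LinearMap.smul_apply, LinearMap.add_apply, smul_eq_mul]
  module

/-- The normal part of `dθ`. -/
theorem dtang_sub_proj (hA : PatchForm A s U) : dtang A s z - patchProj s z (dtang A s z) =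
    (lor n (pd 1 s z) (pd 1 s z))⁻¹ •
      (bil A s Complex.I 1 z • hess s 1 1 z + bil A s Complex.I Complex.I z • hess s 1 Complex.I z
      - bil A s 1 1 z • hess s Complex.I 1 z - bil A s 1 Complex.I z • hess s Complex.I Complex.I z)
    := by
  have hb : ∀ v w, DifferentiableAt ℝ (bil A s v w) z := fun v w =>
    (h.smooth_bil hA v w).diffAt h.isOpen hz
  have hE : DifferentiableAt ℝ (fun w => (lor n (pd 1 s w) (pd 1 s w))⁻¹) z :=
    h.smooth_energy_inv.diffAt h.isOpen hz
  have e : ∀ u v, pd u (tang A s v) z - patchProj s z (pd u (tang A s v) z) =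
      (lor n (pd 1 s z) (pd 1 s z))⁻¹ •
      (bil A s v 1 z • hess s u 1 z + bil A s v Complex.I z • hess s u Complex.I z) := by
    intro u v
    have d1 := (hb v 1).fun_smul (h.diffAt_pd hz 1)
    have d2 := (hb v Complex.I).fun_smul (h.diffAt_pd hz Complex.I)
    have e1 : pd u (tang A s v) z =
        pd u (fun w => (lor n (pd 1 s w) (pd 1 s w))⁻¹) z •
          (bil A s v 1 z • pd 1 s z + bil A s v Complex.I z • pd Complex.I s z)
        + (lor n (pd 1 s z) (pd 1 s z))⁻¹ •
          ((pd u (bil A s v 1) z • pd 1 s z + bil A s v 1 z • pd u (pd 1 s) z) +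
          (pd u (bil A s v Complex.I) z • pd Complex.I s z
            + bil A s v Complex.I z • pd u (pd Complex.I s) z)) := by
      rw [← pd_smul (hb v 1) (h.diffAt_pd hz 1), ← pd_smul (hb v Complex.I)
        (h.diffAt_pd hz Complex.I), ← pd_add d1 d2, ← pd_smul hE (d1.fun_add d2)]
      rfl
    rw [e1]
    simp only [map_add, map_smul, h.patchProj_pd hz, hess, smul_sub, smul_add]
    abel
  have e1 := e 1 Complex.I
  have e2 := e Complex.I 1
  rw [dtang, map_sub, sub_sub_sub_comm, e1, e2, ← smul_sub]
  congr 1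
  abel

/-- The bracket of `𝓝` with `σ ∧ θ`. -/
theorem bracket_eq (hA : PatchForm A s U) :
    ⁅patchN s z 1, A z Complex.I⁆ - ⁅patchN s z Complex.I, A z 1⁆ =
      wedge (s z) (dtang A s z - patchProj s z (dtang A s z)) := by
  have e : ∀ u v, ⁅patchN s z u, A z v⁆ = wedge (s z) ((lor n (pd 1 s z) (pd 1 s z))⁻¹ •
      (bil A s v 1 z • hess s u 1 z + bil A s v Complex.I z • hess s u Complex.I z)) := by
    intro u v
    rw [h.eq_wedge_tang hz hA, lie_wedge (h.lor_patchN hz u), h.patchN_s hz]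
    have : wedge 0 (tang A s v z) = 0 := by rw [wedge_swap, wedge_zero_right, neg_zero]
    rw [this, zero_add]
    congr 1
    rw [tang, map_smul, map_add, map_smul, map_smul, h.patchN_pd hz, h.patchN_pd hz]
    rfl
  rw [e, e, h.dtang_sub_proj hz hA, ← wedge_sub_right, ← smul_sub]
  congr 2
  abel

theorem lor_s_dtang (hA : PatchForm A s U) :
    lor n (s z) (dtang A s z) = bil A s 1 Complex.I z - bil A s Complex.I 1 z := by
  have e : ∀ u v, u = 1 ∨ u = Complex.I →
      lor n (s z) (pd u (tang A s v) z) = - bil A s v u z := by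
    intro u v hu
    have := lor_deriv h.isOpen h.smooth (h.smooth_tang hA v) (fun w hw => h.lor_s_tang hw v) hz u
    rw [h.lor_pd_tang hz v u hu] at this
    linarith
  rw [dtang, map_sub, e 1 _ (Or.inl rfl), e _ 1 (Or.inr rfl)]
  ring

theorem lor_pd_dtang (hA : PatchForm A s U) (w : ℂ) (hw : w = 1 ∨ w = Complex.I) :
    lor n (pd w s z) (dtang A s z) =
      pd 1 (bil A s Complex.I w) z - pd Complex.I (bil A s 1 w) z
        - lor n (pd 1 (pd w s) z) (tang A s Complex.I z)
        + lor n (pd Complex.I (pd w s) z) (tang A s 1 z) := by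
  have e : ∀ u v, lor n (pd w s z) (pd u (tang A s v) z) =
      pd u (bil A s v w) z - lor n (pd u (pd w s) z) (tang A s v z) := by
    intro u v
    have := pd_lor (h.diffAt_pd hz w) ((h.smooth_tang hA v).diffAt h.isOpen hz) u
    rw [pd_congr h.isOpen hz (fun x hx => h.lor_pd_tang hx v w hw)] at this
    rw [this]
    exact (add_sub_cancel_left _ _).symm
  rw [dtang, map_sub, e, e]
  ring

/-- By `proj_eq_smul_iff` the second condition says that dθ is orthogonal to σ, σ₁ and σ₂. The
pairing with σ is the antisymmetric part of b. In the pairings with σ₁ and σ₂ the terms in second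
derivatives of σ cancel, because b is trace-free and symmetric and the chart is conformal; the
Cauchy-Riemann expressions remain. -/
theorem quadAt_iff (hA : PatchForm A s U) : QuadAt A s z ↔
    bil A s 1 1 z + bil A s Complex.I Complex.I z = 0 ∧
      ∃ t : ℝ, patchProj s z (dtang A s z) = t • s z := by
  have r1 := h.pd_conf hz 1
  have r2 := h.pd_conf hz Complex.I
  have r3 := h.pd_orth hz 1
  have r4 := h.pd_orth hz Complex.I
  have r5 := h.pd_comm' hz 1 Complex.I
  have k0 := h.lor_s_dtang hz hA
  have k1 := h.lor_pd_dtang hz hA 1 (Or.inl rfl)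
  have k2 := h.lor_pd_dtang hz hA Complex.I (Or.inr rfl)
  rw [lor_tang, lor_tang] at k1 k2
  rw [← r5] at k1 r4
  rw [← r5] at r2
  rw [r1] at r4
  have hQ : QuadAt A s z ↔ (bil A s 1 1 z + bil A s Complex.I Complex.I z = 0 ∧
      bil A s 1 Complex.I z - bil A s Complex.I 1 z = 0 ∧
      pd 1 (bil A s Complex.I 1) z - pd Complex.I (bil A s 1 1) z = 0 ∧
      pd 1 (bil A s Complex.I Complex.I) z - pd Complex.I (bil A s 1 Complex.I) z = 0) :=
    ⟨fun q => ⟨by rw [q.trace]; ring, by rw [q.symm]; ring, by rw [q.cr₁]; ring,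
      by rw [q.cr₂]; ring⟩, fun ⟨q1, q2, q3, q4⟩ => ⟨by linarith, by linarith, by linarith,
      by linarith⟩⟩
  rw [hQ, patchProj, (h.isFrame hz).proj_eq_smul_iff]
  refine and_congr_right fun q1 => ?_
  rw [k0]
  refine and_congr_right fun q2 => ?_
  have b1 : bil A s Complex.I Complex.I z = - bil A s 1 1 z := by linarith
  have b2 : bil A s 1 Complex.I z = bil A s Complex.I 1 z := by linarith
  rw [b1, b2, r3, r1] at k1
  rw [b1, b2, r1, r2] at k2
  have r4' : lor n (pd 1 s z) (pd Complex.I (pd Complex.I s) z) =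
    - lor n (pd 1 s z) (pd 1 (pd 1 s) z) := by linarith
  rw [r4'] at k2
  refine and_congr (Eq.congr (Eq.trans ?_ k1.symm) rfl) (Eq.congr (Eq.trans ?_ k2.symm) rfl) <;>
  ring

/-- Evaluation on σ₁ gives a combination of σ₂ and σ. The last coordinate, 0 on σ₂ and 1 on σ,
separates the two terms and forces c = 0. -/
theorem wedge_eq_zero_iff (c : ℝ) (x : Mink n) :
    c • wedge (pd 1 s z) (pd Complex.I s z) + wedge (s z) x = 0 ↔ c = 0 ∧ ∃ t : ℝ, x = t • s z := by
  constructor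
  · intro e
    have e1 : c • (lor n (pd 1 s z) (pd 1 s z) • pd Complex.I s z) -
        lor n x (pd 1 s z) • s z = 0 := by
      have := congrArg (fun T : MinkEnd n => T (pd 1 s z)) e
      simpa [wedge_apply, h.orth z hz, sub_eq_add_neg, lor_comm (pd Complex.I s z) (pd 1 s z),
        h.lor_s_pd hz] using this
    have e2 : lor n x (pd 1 s z) = 0 := by
      have := congrArg Prod.snd e1
      simpa [h.snd_pd hz, h.snd_eq z hz] using this
    have hne : pd Complex.I s z ≠ 0 := by
      intro h0
      have := h.pos z hz
      rw [← h.conf z hz, h0, map_zero] at this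
      exact lt_irrefl _ this
    have hc : c = 0 := by
      rw [e2, zero_smul, sub_zero, smul_smul, smul_eq_zero] at e1
      simpa [hne, (h.pos z hz).ne'] using e1
    refine ⟨hc, x.2, ?_⟩
    -- The vector (0, 1) pairs with s to -1, so evaluating s ∧ x on it expresses x as its own last
    -- coordinate times s.
    have e3 : wedge (s z) x ((0, 1) : Mink n) = 0 := by
      rw [hc, zero_smul_end, zero_add] at e
      rw [e]; rfl
    rw [wedge_apply, lor_apply, lor_apply, h.snd_eq z hz, sub_eq_zero] at e3
    simpa using e3
  · rintro ⟨rfl, t, rfl⟩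
    rw [zero_smul_end, zero_add, wedge_smul_right, wedge_self]
    exact smul_zero (A := MinkEnd n) t

/-- `d^𝓓 A = 0` at `z`, in terms of the quadratic differential of `A`. -/
theorem extDD_eq_zero_iff (hA : PatchForm A s U) :
    (pd 1 (fun w => A w Complex.I) z - pd Complex.I (fun w => A w 1) z) -
      (⁅patchN s z 1, A z Complex.I⁆ - ⁅patchN s z Complex.I, A z 1⁆) = 0 ↔ QuadAt A s z := by
  rw [h.ext_eq hz hA, h.bracket_eq hz hA, add_sub_assoc, ← wedge_sub_right, sub_sub_cancel,
    h.wedge_eq_zero_iff hz, h.quadAt_iff hz hA, mul_eq_zero, or_iff_right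
    (inv_ne_zero (h.pos z hz).ne')]

/-- A closed form with values in `Λ ∧ Λ^{(1)}` is `𝓓`-closed and its bracket with `𝓝` vanishes. -/
theorem of_ext_eq_zero (hA : PatchForm A s U)
    (h0 : pd 1 (fun w => A w Complex.I) z - pd Complex.I (fun w => A w 1) z = 0) :
    QuadAt A s z ∧ ⁅patchN s z 1, A z Complex.I⁆ - ⁅patchN s z Complex.I, A z 1⁆ = 0 := by
  have hb : ⁅patchN s z 1, A z Complex.I⁆ - ⁅patchN s z Complex.I, A z 1⁆ = 0 := by
    rw [h.ext_eq hz hA, h.wedge_eq_zero_iff hz] at h0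
    obtain ⟨-, t, ht⟩ := h0
    rw [h.bracket_eq hz hA, ht, map_smul, h.patchProj_s hz, sub_self, wedge_zero_right]
  refine ⟨?_, hb⟩
  rw [← h.extDD_eq_zero_iff hz hA, h0, hb, sub_zero]

theorem hess_comm (v w : ℂ) : hess s v w z = hess s w v z := by
  rw [hess, hess, h.pd_comm' hz]

/-- Δσ lies in S by construction, so the S^⊥-valued Hessian is trace-free. Being symmetric as well,
it is the Hopf differential in real form. -/
theorem hess_trace : hess s Complex.I Complex.I z = - hess s 1 1 z := by
  have e := h.patchProj_lap hz
  rw [lap, map_add] at e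
  rw [hess, hess, eq_neg_iff_add_eq_zero, sub_add_sub_comm, sub_eq_zero, add_comm (pd _ _ _), ← e,
    add_comm (patchProj s z _)]

/-- The bracket of `𝓝` and `A` vanishes if and only if the quadratic differential is a real
multiple of the Hopf differential. -/
theorem bracket_relation (hA : PatchForm A s U) (hQ : QuadAt A s z)
    (h0 : ⁅patchN s z 1, A z Complex.I⁆ - ⁅patchN s z Complex.I, A z 1⁆ = 0) :
    bil A s 1 Complex.I z • hess s 1 1 z = bil A s 1 1 z • hess s 1 Complex.I z := by
  have hp := h.pos z hz
  have e := (h.wedge_eq_zero_iff hz 0 (dtang A s z - patchProj s z (dtang A s z))).1 (by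
    rw [← h.bracket_eq hz hA, h0, zero_smul_end, zero_add])
  obtain ⟨-, t, ht⟩ := e
  -- The S^⊥-part of dθ is a multiple of s, which lies in S; projecting to S shows that the multiple
  -- is zero.
  have hP : patchProj s z (dtang A s z - patchProj s z (dtang A s z)) = 0 := by
    rw [map_sub]
    exact sub_eq_zero.2 ((h.isFrame hz).proj_proj _).symm
  have ht0 : t = 0 := by
    rw [ht, map_smul, h.patchProj_s hz] at hP
    have := congrArg Prod.snd hP
    simpa [h.snd_eq z hz] using this
  rw [h.dtang_sub_proj hz hA, ht0, zero_smul, smul_eq_zero, or_iff_right (inv_ne_zero hp.ne'),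
    h.hess_comm hz Complex.I 1, h.hess_trace hz, hQ.trace, ← hQ.symm] at ht
  -- The factor 2 arises because the symmetry and trace relations of b and of the Hessian make the
  -- four terms equal in pairs.
  have e2 : (2 : ℝ) • (bil A s 1 Complex.I z • hess s 1 1 z) =
      (2 : ℝ) • (bil A s 1 1 z • hess s 1 Complex.I z) := by
    rw [← sub_eq_zero, ← ht]; module
  exact smul_right_injective _ (two_ne_zero' ℝ) e2

end ConfPatch

end

section

variable {n : ℕ} {M : Type*} [TopologicalSpace M] [ChartedSpace ℂ M]

/-! ### Charts of a Riemann surface -/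

/-- The coordinate change from the preferred chart at `x` to the one at `y`. -/
def chartChange (x y : M) (z : ℂ) : ℂ := chartAt ℂ y ((chartAt ℂ x).symm z)

/-- The derivative of the coordinate change from the chart at `x` to the preferred chart at the
point with coordinate `z`. -/
def chartFactor (x : M) (z : ℂ) : ℂ := deriv (chartChange x ((chartAt ℂ x).symm z)) z

/-- The coordinates in the chart at `x` of the points in the chart domain at `y`. -/
def overlap (x y : M) : Set ℂ :=
  (chartAt ℂ x).target ∩ (chartAt ℂ x).symm ⁻¹' (chartAt ℂ y).source

theorem isOpen_overlap (x y : M) : IsOpen (overlap x y) :=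
  (chartAt ℂ x).symm.isOpen_inter_preimage (chartAt ℂ y).open_source

theorem mem_overlap {x : M} {z : ℂ} (hz : z ∈ (chartAt ℂ x).target) :
    z ∈ overlap x ((chartAt ℂ x).symm z) := ⟨hz, mem_chart_source ℂ _⟩

theorem chartChange_mem {x y : M} {z : ℂ} (hz : z ∈ overlap x y) :
    chartChange x y z ∈ (chartAt ℂ y).target := (chartAt ℂ y).map_source hz.2

theorem symm_chartChange {x y : M} {z : ℂ} (hz : z ∈ overlap x y) :
    (chartAt ℂ y).symm (chartChange x y z) = (chartAt ℂ x).symm z := (chartAt ℂ y).left_inv hz.2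

theorem chartChange_self {x : M} {z : ℂ} (hz : z ∈ (chartAt ℂ x).target) :
    chartChange x x z = z := (chartAt ℂ x).right_inv hz

theorem deriv_chartChange_self {x : M} {z : ℂ} (hz : z ∈ (chartAt ℂ x).target) :
    deriv (chartChange x x) z = 1 := by
  have e : chartChange x x =ᶠ[𝓝 z] id := by
    filter_upwards [(chartAt ℂ x).open_target.mem_nhds hz] with w hw
    exact chartChange_self hw
  rw [e.deriv_eq, deriv_id]

theorem chartFactor_center (x : M) : chartFactor x (chartAt ℂ x x) = 1 := by
  rw [chartFactor, (chartAt ℂ x).left_inv (mem_chart_source ℂ x),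
    deriv_chartChange_self (mem_chart_target ℂ x)]

section Complex

variable [IsManifold 𝓘(ℂ) ω M]

theorem contDiffOn_chartChange (x y : M) : ContDiffOn ℂ ω (chartChange x y) (overlap x y) := by
  have h := contDiffOn_ext_coord_change (I := 𝓘(ℂ)) (n := ω) (M := M) y x
  simp only [mfld_simps] at h
  exact h

theorem analyticAt_chartChange {x y : M} {z : ℂ} (hz : z ∈ overlap x y) :
    AnalyticAt ℂ (chartChange x y) z :=
  ((contDiffOn_chartChange x y).contDiffAt ((isOpen_overlap x y).mem_nhds hz)).analyticAt

variable (M) in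
theorem isManifold_real : IsManifold 𝓘(ℝ, ℂ) ∞ M := by
  refine isManifold_of_contDiffOn _ _ _ fun e e' he he' => ?_
  have h := HasGroupoid.compatible (G := contDiffGroupoid ω 𝓘(ℂ)) he he'
  have h2 := (mem_groupoid_of_pregroupoid.1 h).1
  exact (h2.restrict_scalars ℝ).of_le le_top

/-- The cocycle identity for the derivatives of the coordinate changes. -/
theorem deriv_chartChange_mul {x y p : M} {z : ℂ} (hz : z ∈ overlap x y) (hp : z ∈ overlap x p) :
    deriv (chartChange x p) z = deriv (chartChange y p) (chartChange x y z)
      * deriv (chartChange x y) z := by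
  have e : chartChange x p =ᶠ[𝓝 z] chartChange y p ∘ chartChange x y := by
    filter_upwards [(isOpen_overlap x y).mem_nhds hz] with w hw
    rw [Function.comp_apply, chartChange, chartChange, symm_chartChange hw]
  have h1 : chartChange x y z ∈ overlap y p := ⟨chartChange_mem hz, by
    rw [mem_preimage, symm_chartChange hz]; exact hp.2⟩
  rw [e.deriv_eq, deriv_comp _ (analyticAt_chartChange h1).differentiableAt
    (analyticAt_chartChange hz).differentiableAt]

theorem chartFactor_eq {x y : M} {z : ℂ} (hz : z ∈ overlap x y) :
    chartFactor x z = chartFactor y (chartChange x y z) * deriv (chartChange x y) z := by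
  have := deriv_chartChange_mul hz (mem_overlap hz.1)
  rw [chartFactor, this, chartFactor, symm_chartChange hz]

theorem chartFactor_ne_zero {x : M} {z : ℂ} (hz : z ∈ (chartAt ℂ x).target) :
    chartFactor x z ≠ 0 := by
  intro h0
  have h1 : z ∈ overlap x x := ⟨hz, (chartAt ℂ x).map_target hz⟩
  have h2 := deriv_chartChange_mul (mem_overlap hz) h1
  rw [deriv_chartChange_self hz] at h2
  change deriv (chartChange x _) z = 0 at h0
  rw [h0, mul_zero] at h2
  exact one_ne_zero h2

theorem fderiv_chartChange {x y : M} {z : ℂ} (hz : z ∈ overlap x y) (v : ℂ) :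
    fderiv ℝ (chartChange x y) z v = deriv (chartChange x y) z * v := by
  have h := (analyticAt_chartChange hz).differentiableAt.hasDerivAt.hasFDerivAt.restrictScalars ℝ
  rw [h.fderiv]
  simp [mul_comm]

theorem mdifferentiableAt_chart_symm {x : M} {z : ℂ} (hz : z ∈ (chartAt ℂ x).target) :
    MDifferentiableAt 𝓘(ℝ, ℂ) 𝓘(ℝ, ℂ) (chartAt ℂ x).symm z := by
  have := isManifold_real M
  exact ((contMDiffOn_chart_symm (I := 𝓘(ℝ, ℂ)) (n := ∞) (x := x)).contMDiffAt
    ((chartAt ℂ x).open_target.mem_nhds hz)).mdifferentiableAt (by simp)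

/-- The tangent space at a point is identified with ℂ by the preferred chart at that point, not by
the chart at x. Moving along one chart therefore brings in `chartFactor`, which equals 1 only
guaranteedly at the centre. -/
theorem mfderiv_chart_symm {x : M} {z : ℂ} (hz : z ∈ (chartAt ℂ x).target) (v : ℂ) :
    mfderiv 𝓘(ℝ, ℂ) 𝓘(ℝ, ℂ) (chartAt ℂ x).symm z v = chartFactor x z * v := by
  rw [(mdifferentiableAt_chart_symm hz).mfderiv]
  have e : writtenInExtChartAt 𝓘(ℝ, ℂ) 𝓘(ℝ, ℂ) z (chartAt ℂ x).symm =
    chartChange x ((chartAt ℂ x).symm z) := by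
    rfl
  rw [e]
  simp only [mfld_simps, fderivWithin_univ]
  exact fderiv_chartChange (mem_overlap hz) v

theorem inChart_apply {F : Type*} [NormedAddCommGroup F] [NormedSpace ℝ F] (α : OneForm M F)
    {x : M} {z : ℂ} (hz : z ∈ (chartAt ℂ x).target) (v : ℂ) :
    α.inChart x z v = α ((chartAt ℂ x).symm z) (chartFactor x z * v : ℂ) := by
  rw [← mfderiv_chart_symm hz]; rfl

theorem pd_comp_symm {F : Type*} [NormedAddCommGroup F] [NormedSpace ℝ F] {f : M → F}
    {x : M} {z : ℂ} (hz : z ∈ (chartAt ℂ x).target)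
    (hf : MDifferentiableAt 𝓘(ℝ, ℂ) 𝓘(ℝ, F) f ((chartAt ℂ x).symm z)) (v : ℂ) :
    pd v (fun w => f ((chartAt ℂ x).symm w)) z =
      mfderiv 𝓘(ℝ, ℂ) 𝓘(ℝ, F) f ((chartAt ℂ x).symm z) (chartFactor x z * v : ℂ) := by
  have h := mfderiv_comp z hf (mdifferentiableAt_chart_symm hz)
  rw [mfderiv_eq_fderiv] at h
  rw [← mfderiv_chart_symm hz, pd]
  exact congrArg (fun T : ℂ →L[ℝ] F => T v) h

theorem contDiffOn_comp_symm {F : Type*} [NormedAddCommGroup F] [NormedSpace ℝ F] {f : M → F}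
    (hf : ContMDiff 𝓘(ℝ, ℂ) 𝓘(ℝ, F) ∞ f) (x : M) :
    ContDiffOn ℝ ∞ (fun w => f ((chartAt ℂ x).symm w)) (chartAt ℂ x).target := by
  have := isManifold_real M
  exact contMDiffOn_iff_contDiffOn.1
    (hf.comp_contMDiffOn (contMDiffOn_chart_symm (I := 𝓘(ℝ, ℂ)) (n := ∞) (x := x)))

end Complex

/-- The derivative at the centre of the preferred chart. -/
theorem mfderiv_eq_pd {F : Type*} [NormedAddCommGroup F] [NormedSpace ℝ F] {f : M → F} {x : M}
    (hf : MDifferentiableAt 𝓘(ℝ, ℂ) 𝓘(ℝ, F) f x) (v : ℂ) :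
    mfderiv 𝓘(ℝ, ℂ) 𝓘(ℝ, F) f x v = pd v (fun w => f ((chartAt ℂ x).symm w)) (chartAt ℂ x x) := by
  rw [hf.mfderiv]
  have e : writtenInExtChartAt 𝓘(ℝ, ℂ) 𝓘(ℝ, F) x f = fun w => f ((chartAt ℂ x).symm w) := by
    rfl
  rw [e]
  simp only [mfld_simps, fderivWithin_univ]
  rfl

end

section

variable {n : ℕ} {M : Type*} [TopologicalSpace M] [ChartedSpace ℂ M]

/-! ### Normalised lifts -/

/-- A lift of `Λ`, normalised by `σ.2 = 1`. -/
structure IsNormalLift (Λ : M → Submodule ℝ (Mink n)) (σ : M → Mink n) : Prop where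
  lift : IsLift Λ σ
  snd_eq : ∀ x, (σ x).2 = 1

theorem snd_ne_zero_of_null {v : Mink n} (hv : lor n v v = 0) (h0 : v ≠ 0) : v.2 ≠ 0 := by
  intro h2
  rw [lor_apply, h2, mul_zero, sub_zero, inner_self_eq_zero] at hv
  exact h0 (Prod.ext hv h2)

theorem IsLift.null {Λ : M → Submodule ℝ (Mink n)} {σ : M → Mink n} (hσ : IsLift Λ σ)
    (hΛ : IsSurface Λ) (x : M) : lor n (σ x) (σ x) = 0 :=
  hΛ.null x _ (by rw [hσ.span_eq]; exact Submodule.mem_span_singleton_self _)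

theorem contMDiff_snd_lift {σ : M → Mink n} (hσ : ContMDiff 𝓘(ℝ, ℂ) 𝓘(ℝ, Mink n) ∞ σ) :
    ContMDiff 𝓘(ℝ, ℂ) 𝓘(ℝ, ℝ) ∞ fun x => (σ x).2 :=
  (ContinuousLinearMap.snd ℝ (EuclideanSpace ℝ (Fin (n + 1))) ℝ).contMDiff.comp hσ

/-- A non-zero null vector has non-zero last coordinate, so any lift can be divided by it. After
this normalisation dσ takes values in the Euclidean factor. -/
theorem IsSurface.exists_normalLift {Λ : M → Submodule ℝ (Mink n)} (hΛ : IsSurface Λ) :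
    ∃ σ, IsNormalLift Λ σ := by
  obtain ⟨σ, hσ⟩ := hΛ.exists_lift
  have h2 : ∀ x, (σ x).2 ≠ 0 := fun x => snd_ne_zero_of_null (hσ.null hΛ x) (hσ.ne_zero x)
  have hinv : ContMDiff 𝓘(ℝ, ℂ) 𝓘(ℝ, ℝ) ∞ fun x => ((σ x).2)⁻¹ :=
    (contMDiff_snd_lift hσ.smooth).inv₀ h2
  refine ⟨fun x => ((σ x).2)⁻¹ • σ x, ⟨?_, ?_, ?_⟩, ?_⟩
  · exact hinv.smul hσ.smooth
  · exact fun x => smul_ne_zero (inv_ne_zero (h2 x)) (hσ.ne_zero x)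
  · intro x
    rw [hσ.span_eq, Submodule.span_singleton_smul_eq (inv_ne_zero (h2 x)).isUnit]
  · intro x
    simp [h2 x]

/-- The expression of a lift in the preferred chart at `x`. -/
def localLift (σ : M → Mink n) (x : M) (z : ℂ) : Mink n := σ ((chartAt ℂ x).symm z)

theorem laplacian_eq_lap (f : ℂ → Mink n) {U : Set ℂ} (hU : IsOpen U) (hf : ContDiffOn ℝ ∞ f U)
    {z : ℂ} (hz : z ∈ U) : Laplacian.laplacian f z = lap f z := by
  rw [InnerProductSpace.laplacian_eq_iteratedFDeriv_complexPlane, lap, pd_pd hf hU hz,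
    pd_pd hf hU hz]
  simp [iteratedFDeriv_two_apply]

theorem lap_smul {c : ℂ → ℝ} {f : ℂ → Mink n} {U : Set ℂ} (hU : IsOpen U)
    (hc : ContDiffOn ℝ ∞ c U) (hf : ContDiffOn ℝ ∞ f U) {z : ℂ} (hz : z ∈ U) :
    lap (fun w => c w • f w) z = (pd 1 (pd 1 c) z + pd Complex.I (pd Complex.I c) z) • f z +
      (2 * pd 1 c z) • pd 1 f z + (2 * pd Complex.I c z) • pd Complex.I f z + c z • lap f z := by
  have key : ∀ v, pd v (pd v fun w => c w • f w) z =
      pd v (pd v c) z • f z + (2 * pd v c z) • pd v f z + c z • pd v (pd v f) z := by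
    intro v
    have dc := hc.diffAt hU hz
    have df := hf.diffAt hU hz
    have dc' := (hc.pd hU v).diffAt hU hz
    have df' := (hf.pd hU v).diffAt hU hz
    rw [pd_congr hU hz (fun w hw => pd_smul (hc.diffAt hU hw) (hf.diffAt hU hw) v) v,
      pd_add (dc'.fun_smul df) (dc.fun_smul df'), pd_smul dc' df, pd_smul dc df']
    module
  rw [lap, key, key, lap]
  module

variable {Λ : M → Submodule ℝ (Mink n)} {σ : M → Mink n}

theorem IsNormalLift.mdiff (hσ : IsNormalLift Λ σ) (x : M) :
    MDifferentiableAt 𝓘(ℝ, ℂ) 𝓘(ℝ, Mink n) σ x :=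
  (hσ.lift.smooth x).mdifferentiableAt (by simp)

/-- Any lift is a smooth multiple of the normalised lift. -/
theorem IsNormalLift.eq_smul (hσ : IsNormalLift Λ σ) {τ : M → Mink n} (hτ : IsLift Λ τ) (x : M) :
    τ x = (τ x).2 • σ x := by
  have : τ x ∈ Submodule.span ℝ {σ x} := by
    rw [← hσ.lift.span_eq, hτ.span_eq]; exact Submodule.mem_span_singleton_self _
  obtain ⟨t, ht⟩ := Submodule.mem_span_singleton.1 this
  rw [← ht, Prod.smul_snd, hσ.snd_eq, smul_eq_mul, mul_one]

theorem lift_mem (hσ : IsNormalLift Λ σ) {τ : M → Mink n} (hτ : IsLift Λ τ) (x : M) :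
    τ x ∈ Submodule.span ℝ {localLift σ x (chartAt ℂ x x), pd 1 (localLift σ x) (chartAt ℂ x x),
        pd Complex.I (localLift σ x) (chartAt ℂ x x)} := by
  have e : localLift σ x (chartAt ℂ x x) = σ x :=
    congrArg σ ((chartAt ℂ x).left_inv (mem_chart_source ℂ x))
  rw [hσ.eq_smul hτ, ← e]
  exact Submodule.smul_mem _ _ (Submodule.subset_span (by simp))

section Complex

variable [IsManifold 𝓘(ℂ) ω M]

theorem pd_local (hσ : IsNormalLift Λ σ) {x : M} {z : ℂ} (hz : z ∈ (chartAt ℂ x).target) (v : ℂ) :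
    pd v (localLift σ x) z = dvec σ ((chartAt ℂ x).symm z) (chartFactor x z * v : ℂ) :=
  pd_comp_symm hz (hσ.mdiff _) v

theorem dvec_snd (hσ : IsNormalLift Λ σ) (x : M) (v : ℂ) : (dvec σ x v).2 = 0 := by
  have hz := mem_chart_target ℂ x
  have hs : ContDiffOn ℝ ∞ (localLift σ x) _ := contDiffOn_comp_symm hσ.lift.smooth x
  have e : dvec σ x v = pd v (localLift σ x) (chartAt ℂ x x) := mfderiv_eq_pd (hσ.mdiff x) v
  rw [e, ← pd_snd (hs.diffAt (chartAt ℂ x).open_target hz)]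
  exact (pd_congr (chartAt ℂ x).open_target hz (fun w _ => hσ.snd_eq _) v).trans (pd_const _ _ _)

/-- A normalised lift of a conformal immersion in the preferred charts. -/
theorem IsNormalLift.confPatch (hσ : IsNormalLift Λ σ) (hΛ : IsSurface Λ) (x : M) :
    ConfPatch (localLift σ x) (chartAt ℂ x).target where
  isOpen := (chartAt ℂ x).open_target
  smooth := contDiffOn_comp_symm hσ.lift.smooth x
  snd_eq := fun z _ => hσ.snd_eq _
  null := fun z _ => hσ.lift.null hΛ _
  conf := by
    intro z hz
    have h := hΛ.conformal σ hσ.lift ((chartAt ℂ x).symm z) (chartFactor x z : ℂ)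
      (chartFactor x z : ℂ)
    rw [pd_local hσ hz, pd_local hσ hz, mul_one, mul_comm]
    exact h
  orth := by
    intro z hz
    -- Conformality for the pair X, JX reads (JX, -X) = (X, JX), so this pairing vanishes.
    have h := hΛ.conformal σ hσ.lift ((chartAt ℂ x).symm z) (chartFactor x z * 1 : ℂ)
      (chartFactor x z * Complex.I : ℂ)
    have e1 : J ((chartAt ℂ x).symm z) (chartFactor x z * 1 : ℂ) =
      (chartFactor x z * Complex.I : ℂ) := by
      change Complex.I * _ = _; ring
    have e2 : J ((chartAt ℂ x).symm z) (chartFactor x z * Complex.I : ℂ) =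
      (-(chartFactor x z * 1) : ℂ) := by
      change Complex.I * _ = _; linear_combination chartFactor x z * Complex.I_mul_I
    rw [e1, e2] at h
    have e3 : dvec σ ((chartAt ℂ x).symm z) (-(chartFactor x z * 1) : ℂ) =
      - dvec σ ((chartAt ℂ x).symm z) (chartFactor x z * 1 : ℂ) := map_neg _ _
    rw [e3, ← pd_local hσ hz, ← pd_local hσ hz, map_neg, lor_comm] at h
    linarith
  pos := by
    intro z hz
    have h2 : (pd 1 (localLift σ x) z).2 = 0 := by
      rw [pd_local hσ hz]; exact dvec_snd hσ _ _
    -- With last coordinate zero the Lorentzian norm is Euclidean, so positivity reduces to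
    -- injectivity of the differential.
    rw [lor_apply, h2, mul_zero, sub_zero]
    refine real_inner_self_pos.2 fun h1 => ?_
    have h0 : pd 1 (localLift σ x) z = 0 := Prod.ext h1 h2
    rw [pd_local hσ hz, mul_one] at h0
    exact chartFactor_ne_zero hz (hΛ.immersion σ hσ.lift _ _ (h0 ▸ zero_mem _))

theorem lift_local (hσ : IsNormalLift Λ σ) {τ : M → Mink n} (hτ : IsLift Λ τ) (x : M) :
    ∃ c : ℂ → ℝ, ContDiffOn ℝ ∞ c (chartAt ℂ x).target ∧
      localLift τ x = fun w => c w • localLift σ x w :=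
  ⟨fun w => (τ ((chartAt ℂ x).symm w)).2, contDiffOn_comp_symm (contMDiff_snd_lift hτ.smooth) x,
    funext fun _ => hσ.eq_smul hτ _⟩

theorem dvec_lift_mem (hσ : IsNormalLift Λ σ) (hΛ : IsSurface Λ) {τ : M → Mink n}
    (hτ : IsLift Λ τ) (x : M) (v : ℂ) : dvec τ x v ∈ Submodule.span ℝ
      {localLift σ x (chartAt ℂ x x), pd 1 (localLift σ x) (chartAt ℂ x x),
        pd Complex.I (localLift σ x) (chartAt ℂ x x)} := by
  have hp := hσ.confPatch hΛ x
  have hz := mem_chart_target ℂ x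
  obtain ⟨c, hc, e⟩ := lift_local hσ hτ x
  have e1 : dvec τ x v = pd v (localLift τ x) (chartAt ℂ x x) :=
    mfderiv_eq_pd ((hτ.smooth x).mdifferentiableAt (by simp)) v
  rw [e1, e, pd_smul (hc.diffAt hp.isOpen hz) (hp.diffAt hz), pd_dir_eq (localLift σ x) _ v]
  refine add_mem (Submodule.smul_mem _ _ ?_)
    (Submodule.smul_mem _ _ (add_mem (Submodule.smul_mem _ _ ?_) (Submodule.smul_mem _ _ ?_)))
  all_goals exact Submodule.subset_span (by simp)

theorem firstBundle_le (hσ : IsNormalLift Λ σ) (hΛ : IsSurface Λ) (x : M) :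
    firstBundle Λ x ≤ Submodule.span ℝ {localLift σ x (chartAt ℂ x x),
      pd 1 (localLift σ x) (chartAt ℂ x x), pd Complex.I (localLift σ x) (chartAt ℂ x x)} := by
  refine Submodule.span_le.2 ?_
  rintro v ⟨τ, hτ, rfl | ⟨X, rfl⟩⟩
  · exact lift_mem hσ hτ x
  · exact dvec_lift_mem hσ hΛ hτ x X

theorem centralSphere_eq (hσ : IsNormalLift Λ σ) (hΛ : IsSurface Λ) (x : M) :
    centralSphere Λ x = Submodule.span ℝ {localLift σ x (chartAt ℂ x x),
      pd 1 (localLift σ x) (chartAt ℂ x x), pd Complex.I (localLift σ x) (chartAt ℂ x x),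
      lap (localLift σ x) (chartAt ℂ x x)} := by
  have hp := hσ.confPatch hΛ x
  have hz := mem_chart_target ℂ x
  have hle : Submodule.span ℝ {localLift σ x (chartAt ℂ x x), pd 1 (localLift σ x) (chartAt ℂ x x),
      pd Complex.I (localLift σ x) (chartAt ℂ x x)} ≤ Submodule.span ℝ {localLift σ x (chartAt ℂ x x),
      pd 1 (localLift σ x) (chartAt ℂ x x), pd Complex.I (localLift σ x) (chartAt ℂ x x),
      lap (localLift σ x) (chartAt ℂ x x)} := by
    refine Submodule.span_mono ?_
    rintro v (rfl | rfl | rfl) <;> simp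
  have e0 : localLift σ x (chartAt ℂ x x) = σ x :=
    congrArg σ ((chartAt ℂ x).left_inv (mem_chart_source ℂ x))
  have e1 : ∀ v, pd v (localLift σ x) (chartAt ℂ x x) = dvec σ x v :=
    fun v => (mfderiv_eq_pd (hσ.mdiff x) v).symm
  refine le_antisymm (Submodule.span_le.2 ?_) (Submodule.span_le.2 ?_)
  · rintro v ⟨τ, hτ, rfl | ⟨X, rfl⟩ | rfl⟩
    · exact hle (lift_mem hσ hτ x)
    · exact hle (dvec_lift_mem hσ hΛ hτ x X)
    · obtain ⟨c, hc, e⟩ := lift_local hσ hτ x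
      have hcs : ContDiffOn ℝ ∞ (fun w => c w • localLift σ x w) (chartAt ℂ x).target :=
        hc.smul hp.smooth
      change Laplacian.laplacian (localLift τ x) (chartAt ℂ x x) ∈ _
      rw [e, laplacian_eq_lap _ hp.isOpen hcs hz, lap_smul hp.isOpen hc hp.smooth hz]
      refine add_mem (add_mem (add_mem ?_ ?_) ?_) ?_
      all_goals exact Submodule.smul_mem _ _ (Submodule.subset_span (by simp))
  · rintro v (rfl | rfl | rfl | rfl)
    · exact Submodule.subset_span ⟨σ, hσ.lift, Or.inl e0⟩
    · exact Submodule.subset_span ⟨σ, hσ.lift, Or.inr (Or.inl ⟨(1 : ℂ), e1 _⟩)⟩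
    · exact Submodule.subset_span ⟨σ, hσ.lift, Or.inr (Or.inl ⟨Complex.I, e1 _⟩)⟩
    · exact Submodule.subset_span ⟨σ, hσ.lift, Or.inr (Or.inr
        (laplacian_eq_lap _ hp.isOpen hp.smooth hz).symm)⟩

end Complex

end

section

variable {n : ℕ} {M : Type*} [TopologicalSpace M] [ChartedSpace ℂ M]

/-! ### Changing charts -/

variable {Λ : M → Submodule ℝ (Mink n)} {σ : M → Mink n}

theorem localLift_center (σ : M → Mink n) (x : M) : localLift σ x (chartAt ℂ x x) = σ x :=
  congrArg σ ((chartAt ℂ x).left_inv (mem_chart_source ℂ x))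

theorem pd_localLift_center (hσ : IsNormalLift Λ σ) (x : M) (v : ℂ) :
    pd v (localLift σ x) (chartAt ℂ x x) = dvec σ x v :=
  (mfderiv_eq_pd (hσ.mdiff x) v).symm

section Complex

variable [IsManifold 𝓘(ℂ) ω M]

theorem pd_localLift_eq (hσ : IsNormalLift Λ σ) {x y : M} {z : ℂ}
    (hz : z ∈ (chartAt ℂ x).target) (hy : (chartAt ℂ x).symm z = y) (v : ℂ) :
    pd v (localLift σ x) z = pd (chartFactor x z * v) (localLift σ y) (chartAt ℂ y y) := by
  subst hy
  rw [pd_localLift_center hσ, pd_local hσ hz]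

/-- Second derivatives of the normalised lift in different charts. -/
theorem pd_pd_localLift_eq (hσ : IsNormalLift Λ σ) {x y : M} {z : ℂ}
    (hz : z ∈ (chartAt ℂ x).target) (hy : (chartAt ℂ x).symm z = y) (v w : ℂ) :
    ∃ u : ℂ, pd v (pd w (localLift σ x)) z =
      pd (chartFactor x z * v) (pd (chartFactor x z * w) (localLift σ y)) (chartAt ℂ y y) +
      pd u (localLift σ y) (chartAt ℂ y y) := by
  have ho : z ∈ overlap x y := hy ▸ mem_overlap hz
  have hc : chartFactor x z = deriv (chartChange x y) z := by rw [← hy]; rfl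
  have hcy : chartChange x y z = chartAt ℂ y y := by rw [chartChange, hy]
  have hU := (chartAt ℂ y).open_target
  have hs : ContDiffOn ℝ ∞ (localLift σ y) (chartAt ℂ y).target :=
    contDiffOn_comp_symm hσ.lift.smooth y
  have hs' := hs.fderiv_of_isOpen hU (m := ∞) (by simp)
  have hyt := mem_chart_target ℂ y
  have hτ : ∀ u ∈ overlap x y, HasFDerivAt (chartChange x y) (fderiv ℝ (chartChange x y) u) u :=
    fun u hu => ((analyticAt_chartChange hu).differentiableAt.restrictScalars ℝ).hasFDerivAt
  have e1 : ∀ u ∈ overlap x y, pd w (localLift σ x) u =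
      fderiv ℝ (localLift σ y) (chartChange x y u) (deriv (chartChange x y) u * w) := by
    intro u hu
    rw [pd_congr (f := localLift σ x) (isOpen_overlap x y) hu (g := fun u => localLift σ y (chartChange x y u))
      (fun u hu => congrArg σ (symm_chartChange hu).symm)]
    have h := ((hs.diffAt hU (chartChange_mem hu)).hasFDerivAt.comp u (hτ u hu)).fderiv
    rw [← fderiv_chartChange hu]
    exact congrArg (fun T : ℂ →L[ℝ] Mink n => T w) h
  have hT := (hs'.diffAt hU (chartChange_mem ho)).hasFDerivAt.comp z (hτ z ho)
  have hd : DifferentiableAt ℝ (fun u => deriv (chartChange x y) u * w) z :=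
    ((analyticAt_chartChange ho).deriv.differentiableAt.restrictScalars ℝ).mul_const w
  -- The chain rule leaves one first-order term, along the derivative of the transition factor. It
  -- is tangential, hence invisible modulo S.
  refine ⟨pd v (fun u => deriv (chartChange x y) u * w) z, ?_⟩
  have e2 := pd_apply hT.differentiableAt hd v
  rw [pd_congr (isOpen_overlap x y) ho e1, pd_pd hs hU hyt, hc]
  refine e2.trans ?_
  have e3 : pd v (fderiv ℝ (localLift σ y) ∘ chartChange x y) z =
      fderiv ℝ (fderiv ℝ (localLift σ y)) (chartAt ℂ y y) (deriv (chartChange x y) z * v) := by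
    rw [← fderiv_chartChange ho, ← hcy]
    exact congrArg (fun T : ℂ →L[ℝ] (ℂ →L[ℝ] Mink n) => T v) hT.fderiv
  rw [e3, Function.comp_apply, hcy]
  rfl

/-- The derivative of a holomorphic coordinate change is multiplication by c, which scales the trace
of a bilinear form by |c|². -/
theorem lap_localLift_eq (hσ : IsNormalLift Λ σ) {x y : M} {z : ℂ}
    (hz : z ∈ (chartAt ℂ x).target) (hy : (chartAt ℂ x).symm z = y) :
    ∃ u : ℂ, lap (localLift σ x) z = Complex.normSq (chartFactor x z) •
      lap (localLift σ y) (chartAt ℂ y y) + pd u (localLift σ y) (chartAt ℂ y y) := by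
  obtain ⟨u₁, h₁⟩ := pd_pd_localLift_eq hσ hz hy 1 1
  obtain ⟨u₂, h₂⟩ := pd_pd_localLift_eq hσ hz hy Complex.I Complex.I
  refine ⟨u₁ + u₂, ?_⟩
  have hU := (chartAt ℂ y).open_target
  have hs : ContDiffOn ℝ ∞ (localLift σ y) (chartAt ℂ y).target :=
    contDiffOn_comp_symm hσ.lift.smooth y
  have hyt := mem_chart_target ℂ y
  have hadd : pd (u₁ + u₂) (localLift σ y) (chartAt ℂ y y) =
    pd u₁ (localLift σ y) (chartAt ℂ y y) + pd u₂ (localLift σ y) (chartAt ℂ y y) := map_add _ _ _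
  have key : ∀ B : ℂ →L[ℝ] ℂ →L[ℝ] Mink n, ∀ c : ℂ, B (c * 1) (c * 1) +
      B (c * Complex.I) (c * Complex.I) =
      Complex.normSq c • (B 1 1 + B Complex.I Complex.I) := by
    intro B c
    have e1 : c * 1 = c.re • (1 : ℂ) + c.im • Complex.I := by
      simp [Complex.re_add_im]
    have e2 : c * Complex.I = (-c.im) • (1 : ℂ) + c.re • Complex.I := by
      apply Complex.ext <;> simp
    rw [e1, e2]
    simp only [map_add, map_smul, add_apply, smul_apply, Complex.normSq_apply]
    module
  rw [lap, h₁, h₂, hadd, lap, pd_pd hs hU hyt, pd_pd hs hU hyt, pd_pd hs hU hyt,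
    pd_pd hs hU hyt, ← key]
  abel

theorem pd_center_eq (hσ : IsNormalLift Λ σ) {x y : M} {z : ℂ}
    (hz : z ∈ (chartAt ℂ x).target) (hy : (chartAt ℂ x).symm z = y) (v : ℂ) :
    pd v (localLift σ y) (chartAt ℂ y y) = pd ((chartFactor x z)⁻¹ * v) (localLift σ x) z := by
  rw [pd_localLift_eq hσ hz hy, mul_inv_cancel_left₀ (chartFactor_ne_zero hz)]

theorem pd_mem_span (s : ℂ → Mink n) (z v : ℂ) (T : Set (Mink n))
    (h1 : pd 1 s z ∈ T) (h2 : pd Complex.I s z ∈ T) : pd v s z ∈ Submodule.span ℝ T := by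
  rw [pd_dir_eq]
  exact add_mem (Submodule.smul_mem _ _ (Submodule.subset_span h1))
    (Submodule.smul_mem _ _ (Submodule.subset_span h2))

/-- `centralSphere` at y is built from the chart centred at y. Here it is compared with the frame of
one fixed chart, in which it can be differentiated. -/
theorem span_frame_eq (hσ : IsNormalLift Λ σ) {x y : M} {z : ℂ}
    (hz : z ∈ (chartAt ℂ x).target) (hy : (chartAt ℂ x).symm z = y) :
    Submodule.span ℝ {localLift σ y (chartAt ℂ y y), pd 1 (localLift σ y) (chartAt ℂ y y),
      pd Complex.I (localLift σ y) (chartAt ℂ y y), lap (localLift σ y) (chartAt ℂ y y)} =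
    Submodule.span ℝ {localLift σ x z, pd 1 (localLift σ x) z, pd Complex.I (localLift σ x) z,
      lap (localLift σ x) z} := by
  obtain ⟨u, hu⟩ := lap_localLift_eq hσ hz hy
  have hc : Complex.normSq (chartFactor x z) ≠ 0 := by
    simpa using chartFactor_ne_zero hz
  have e0 : localLift σ y (chartAt ℂ y y) = localLift σ x z := by
    rw [localLift_center, localLift, hy]
  refine le_antisymm (Submodule.span_le.2 ?_) (Submodule.span_le.2 ?_)
  · rintro v (rfl | rfl | rfl | rfl)
    · rw [e0]; exact Submodule.subset_span (by simp)
    · rw [pd_center_eq hσ hz hy]; exact pd_mem_span _ _ _ _ (by simp) (by simp)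
    · rw [pd_center_eq hσ hz hy]; exact pd_mem_span _ _ _ _ (by simp) (by simp)
    · have e : lap (localLift σ y) (chartAt ℂ y y) = (Complex.normSq (chartFactor x z))⁻¹ •
          (lap (localLift σ x) z - pd u (localLift σ y) (chartAt ℂ y y)) := by
        rw [hu, add_sub_cancel_right, smul_smul, inv_mul_cancel₀ hc, one_smul]
      rw [e, pd_center_eq hσ hz hy]
      exact Submodule.smul_mem _ _ (sub_mem (Submodule.subset_span (by simp))
        (pd_mem_span _ _ _ _ (by simp) (by simp)))
  · rintro v (rfl | rfl | rfl | rfl)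
    · rw [← e0]; exact Submodule.subset_span (by simp)
    · rw [pd_localLift_eq hσ hz hy]; exact pd_mem_span _ _ _ _ (by simp) (by simp)
    · rw [pd_localLift_eq hσ hz hy]; exact pd_mem_span _ _ _ _ (by simp) (by simp)
    · rw [hu]
      exact add_mem (Submodule.smul_mem _ _ (Submodule.subset_span (by simp)))
        (pd_mem_span _ _ _ _ (by simp) (by simp))

/-- The projection onto the central sphere congruence in a chart. -/
theorem projS_eq (hσ : IsNormalLift Λ σ) (hΛ : IsSurface Λ) {x : M} {z : ℂ}
    (hz : z ∈ (chartAt ℂ x).target) :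
    projS Λ ((chartAt ℂ x).symm z) = patchProj (localLift σ x) z := by
  rw [projS, centralSphere_eq hσ hΛ, span_frame_eq hσ hz rfl, patchProj,
    ((hσ.confPatch hΛ x).isFrame hz).orthProj_span]

theorem patchProj_eq (hσ : IsNormalLift Λ σ) (hΛ : IsSurface Λ) {x y : M} {z : ℂ}
    (hz : z ∈ (chartAt ℂ x).target) (hy : (chartAt ℂ x).symm z = y) :
    patchProj (localLift σ x) z = patchProj (localLift σ y) (chartAt ℂ y y) := by
  rw [← projS_eq hσ hΛ hz, ← projS_eq hσ hΛ (mem_chart_target ℂ y), hy,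
    (chartAt ℂ y).left_inv (mem_chart_source ℂ y)]

/-- The first-order term in the change of second derivatives lies in S, so the S^⊥-valued Hessian is
tensorial. -/
theorem hess_eq (hσ : IsNormalLift Λ σ) (hΛ : IsSurface Λ) {x y : M} {z : ℂ}
    (hz : z ∈ (chartAt ℂ x).target) (hy : (chartAt ℂ x).symm z = y) (v w : ℂ) :
    hess (localLift σ x) v w z =
      hess (localLift σ y) (chartFactor x z * v) (chartFactor x z * w) (chartAt ℂ y y) := by
  obtain ⟨u, hu⟩ := pd_pd_localLift_eq hσ hz hy v w
  rw [hess, hess, patchProj_eq hσ hΛ hz hy, hu, map_add,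
    (hσ.confPatch hΛ y).patchProj_pd (mem_chart_target ℂ y)]
  abel

theorem mdifferentiableAt_projS (hσ : IsNormalLift Λ σ) (hΛ : IsSurface Λ) (x : M) :
    MDifferentiableAt 𝓘(ℝ, ℂ) 𝓘(ℝ, MinkEnd n) (projS Λ) x := by
  have := isManifold_real M
  have hp := hσ.confPatch hΛ x
  have e : projS Λ =ᶠ[𝓝 x] fun y => patchProj (localLift σ x) (chartAt ℂ x y) := by
    filter_upwards [(chartAt ℂ x).open_source.mem_nhds (mem_chart_source ℂ x)] with y hy
    rw [← projS_eq hσ hΛ ((chartAt ℂ x).map_source hy), (chartAt ℂ x).left_inv hy]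
  refine MDifferentiableAt.congr_of_eventuallyEq ?_ e
  have h1 : MDifferentiableAt 𝓘(ℝ, ℂ) 𝓘(ℝ, ℂ) (chartAt ℂ x) x :=
    ((contMDiffOn_chart (I := 𝓘(ℝ, ℂ)) (n := ∞) (x := x)).contMDiffAt
      ((chartAt ℂ x).open_source.mem_nhds (mem_chart_source ℂ x))).mdifferentiableAt (by simp)
  exact ((hp.diffAt_patchProj (mem_chart_target ℂ x)).mdifferentiableAt).comp x h1

theorem dProjS_eq (hσ : IsNormalLift Λ σ) (hΛ : IsSurface Λ) (x : M) (v : ℂ) :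
    dProjS Λ x v = pd v (patchProj (localLift σ x)) (chartAt ℂ x x) := by
  have h := mfderiv_eq_pd (mdifferentiableAt_projS hσ hΛ x) v
  rw [dProjS]
  refine h.trans (pd_congr (chartAt ℂ x).open_target (mem_chart_target ℂ x)
    (fun w hw => projS_eq hσ hΛ hw) v)

theorem formN_eq (hσ : IsNormalLift Λ σ) (hΛ : IsSurface Λ) (x : M) (v : ℂ) :
    formN Λ x v = patchN (localLift σ x) (chartAt ℂ x x) v := by
  have e : projS Λ x = patchProj (localLift σ x) (chartAt ℂ x x) := by
    rw [← projS_eq hσ hΛ (mem_chart_target ℂ x), (chartAt ℂ x).left_inv (mem_chart_source ℂ x)]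
  rw [patchN, ← dProjS_eq hσ hΛ, ← e]
  rfl

/-! ### Admissible forms in charts -/

/-- Wedging with σ discards the σ-component of an element of Λ^(1), and Λ is a line, so every
element of the span is a single wedge of σ with a tangential vector. -/
theorem mem_wedgeSpan (hσ : IsNormalLift Λ σ) (hΛ : IsSurface Λ) {x y : M} {z : ℂ}
    (hz : z ∈ (chartAt ℂ x).target) (hy : (chartAt ℂ x).symm z = y) {T : MinkEnd n}
    (hT : T ∈ wedgeSpan (Λ y) (firstBundle Λ y)) :
    ∃ t₁ t₂ : ℝ, T = wedge (localLift σ x z)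
      (t₁ • pd 1 (localLift σ x) z + t₂ • pd Complex.I (localLift σ x) z) := by
  have e0 : localLift σ y (chartAt ℂ y y) = localLift σ x z := by
    rw [localLift_center, localLift, hy]
  have key : ∀ v ∈ firstBundle Λ y, ∃ t₁ t₂ : ℝ, wedge (localLift σ x z) v =
      wedge (localLift σ x z)
        (t₁ • pd 1 (localLift σ x) z + t₂ • pd Complex.I (localLift σ x) z) := by
    intro v hv
    have hv := firstBundle_le hσ hΛ y hv
    rw [Submodule.mem_span_insert] at hv
    obtain ⟨a, w, hw, rfl⟩ := hv
    obtain ⟨b, c, rfl⟩ := Submodule.mem_span_pair.1 hw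
    have e1 : b • pd 1 (localLift σ y) (chartAt ℂ y y) +
        c • pd Complex.I (localLift σ y) (chartAt ℂ y y) =
        pd ((chartFactor x z)⁻¹ * ((b : ℂ) + c * Complex.I)) (localLift σ x) z := by
      rw [← pd_center_eq hσ hz hy, pd_dir_eq _ _ ((b : ℂ) + c * Complex.I)]
      simp
    refine ⟨((chartFactor x z)⁻¹ * ((b : ℂ) + c * Complex.I)).re,
      ((chartFactor x z)⁻¹ * ((b : ℂ) + c * Complex.I)).im, ?_⟩
    rw [e1, pd_dir_eq, e0, wedge_add_right, wedge_smul_right, wedge_self]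
    exact add_eq_right.2 (smul_zero (A := MinkEnd n) a)
  induction hT using Submodule.span_induction with
  | mem T hT =>
    obtain ⟨u, hu, v, hv, rfl⟩ := hT
    rw [hσ.lift.span_eq] at hu
    obtain ⟨a, rfl⟩ := Submodule.mem_span_singleton.1 hu
    obtain ⟨t₁, t₂, ht⟩ := key v hv
    refine ⟨a * t₁, a * t₂, ?_⟩
    rw [← localLift_center σ y, e0, wedge_smul_left, ht, ← wedge_smul_right]
    congr 1
    module
  | zero => exact ⟨0, 0, by simp⟩
  | add S T _ _ hS hT =>
    obtain ⟨a, b, rfl⟩ := hS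
    obtain ⟨c, d, rfl⟩ := hT
    refine ⟨a + c, b + d, ?_⟩
    rw [← wedge_add_right]
    congr 1
    module
  | smul t T _ hT =>
    obtain ⟨a, b, rfl⟩ := hT
    refine ⟨t * a, t * b, ?_⟩
    rw [← wedge_smul_right]
    congr 1
    module

theorem IsAdmissible.patchForm {α : OneForm M (MinkEnd n)} (hα : IsAdmissible Λ α)
    (hσ : IsNormalLift Λ σ) (hΛ : IsSurface Λ) (x : M) :
    PatchForm (α.inChart x) (localLift σ x) (chartAt ℂ x).target where
  smooth := hα.smooth x
  mem := fun z hz v => by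
    rw [inChart_apply α hz]
    exact mem_wedgeSpan hσ hΛ hz rfl (hα.mem _ _)

/-- The bilinear form of an admissible form in different charts. -/
theorem bil_eq (hσ : IsNormalLift Λ σ) (α : OneForm M (MinkEnd n)) {x y : M} {z : ℂ}
    (hz : z ∈ (chartAt ℂ x).target) (hy : (chartAt ℂ x).symm z = y) (v w : ℂ) :
    bil (α.inChart x) (localLift σ x) v w z =
      bil (α.inChart y) (localLift σ y) (chartFactor x z * v) (chartFactor x z * w)
        (chartAt ℂ y y) := by
  subst hy
  rw [bil, bil, pd_localLift_eq hσ hz rfl, inChart_apply α hz,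
    inChart_apply α (mem_chart_target ℂ _), chartFactor_center, one_mul,
    (chartAt ℂ ((chartAt ℂ x).symm z)).left_inv (mem_chart_source ℂ _)]

end Complex

end

section

variable {n : ℕ} {M : Type*} [TopologicalSpace M] [ChartedSpace ℂ M]

/-! ### Two-forms -/

section TwoForms

variable {F : Type*} [NormedAddCommGroup F] [NormedSpace ℝ F]

theorem alternating_expand (B : ℂ →L[ℝ] ℂ →L[ℝ] F) (X Y : ℂ) : B X Y - B Y X =
    (X.re * Y.im - X.im * Y.re) • (B 1 Complex.I - B Complex.I 1) := by
  have e : ∀ X : ℂ, X = X.re • (1 : ℂ) + X.im • Complex.I := fun X => by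
    simp [Complex.re_add_im]
  conv_lhs => rw [e X, e Y]
  simp only [map_add, map_smul, add_apply, smul_apply]
  module

/-- The value of a one-form at a vector given by its coordinate in the preferred chart. -/
def OneForm.ev (α : OneForm M F) (x : M) (v : ℂ) : F := α x v

/-- The value of `dα` on the coordinate frame. -/
def OneForm.extD₁ (α : OneForm M F) (x : M) : F := α.extD x (1 : ℂ) Complex.I

theorem extD_eq_zero_iff (α : OneForm M F) (x : M) :
    (∀ X Y : TangentSpace 𝓘(ℝ, ℂ) x, α.extD x X Y = 0) ↔ α.extD₁ x = 0 := by
  refine ⟨fun h => h (1 : ℂ) Complex.I, fun h X Y => ?_⟩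
  refine (alternating_expand (fderiv ℝ (α.inChart x) (chartAt ℂ x x)) X Y).trans ?_
  exact (congrArg _ h).trans (smul_zero _)

theorem ev_star (α : OneForm M F) (x : M) (v : ℂ) : α.star.ev x v = - α.ev x (Complex.I * v) := rfl

theorem ev_expand (α : OneForm M F) (x : M) (v : ℂ) :
    α.ev x v = v.re • α.ev x 1 + v.im • α.ev x Complex.I := by
  have h : ∀ A : ℂ →L[ℝ] F, A v = v.re • A 1 + v.im • A Complex.I := fun A => by
    rw [← map_smul, ← map_smul, ← map_add]
    congr 1
    simp [Complex.re_add_im]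
  exact h (α x)

theorem ev_star_one (α : OneForm M F) (x : M) : α.star.ev x 1 = - α.ev x Complex.I := by
  rw [ev_star, mul_one]

theorem ev_star_I (α : OneForm M F) (x : M) : α.star.ev x Complex.I = α.ev x 1 := by
  rw [ev_star, ev_expand]; simp

theorem ext_ev {α β : OneForm M F} (h : ∀ x v, α.ev x v = β.ev x v) : α = β :=
  funext fun x => ContinuousLinearMap.ext fun v => h x v

theorem star_star (α : OneForm M F) : α.star.star = -α := by
  refine ext_ev fun x v => ?_
  change _ = - α.ev x v
  rw [ev_star, ev_star, neg_neg, ← mul_assoc, Complex.I_mul_I, ev_expand, ev_expand α x v]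
  simp
  abel

end TwoForms

theorem lie_apply_end (S T : MinkEnd n) (w : Mink n) : ⁅S, T⁆ w = S (T w) - T (S w) := rfl

theorem end_smul_zero (t : ℝ) : t • (0 : MinkEnd n) = 0 := by
  refine ContinuousLinearMap.ext fun w => ?_
  exact smul_zero t

/-- The value of `[α ∧ η]` on the coordinate frame. -/
def bracketWedge₁ (α η : OneForm M (MinkEnd n)) (x : M) : MinkEnd n :=
  ⁅α.ev x 1, η.ev x Complex.I⁆ - ⁅α.ev x Complex.I, η.ev x 1⁆

/-- Two-forms on a surface are determined by their value on (1, i). The same factor t serves the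
bracket and every exterior derivative, so the two parts of `extDD` can be compared. -/
theorem bracketWedge_expand (α η : OneForm M (MinkEnd n)) (x : M)
    (X Y : TangentSpace 𝓘(ℝ, ℂ) x) : ∃ t : ℝ, bracketWedge α η x X Y = t • bracketWedge₁ α η x ∧
      ∀ β : OneForm M (MinkEnd n), β.extD x X Y = t • β.extD₁ x := by
  refine ⟨(X : ℂ).re * (Y : ℂ).im - (X : ℂ).im * (Y : ℂ).re, ?_, fun β =>
    alternating_expand (fderiv ℝ (β.inChart x) (chartAt ℂ x x)) X Y⟩
  have h : ∀ X Y : ℂ, ⁅α.ev x X, η.ev x Y⁆ - ⁅α.ev x Y, η.ev x X⁆ =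
      (X.re * Y.im - X.im * Y.re) • bracketWedge₁ α η x := by
    intro X Y
    rw [ev_expand α x X, ev_expand η x X, ev_expand α x Y, ev_expand η x Y]
    refine ContinuousLinearMap.ext fun w => ?_
    simp only [bracketWedge₁, sub_apply, add_apply, smul_apply, lie_apply_end, map_add, map_smul]
    module
  exact h X Y

theorem bracketWedge_eq_zero (α η : OneForm M (MinkEnd n)) (x : M) (h : bracketWedge₁ α η x = 0)
    (X Y : TangentSpace 𝓘(ℝ, ℂ) x) : bracketWedge α η x X Y = 0 := by
  obtain ⟨t, ht, -⟩ := bracketWedge_expand α η x X Y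
  rw [ht, h, end_smul_zero]

theorem extDD_eq_zero_iff (Λ : M → Submodule ℝ (Mink n)) (α : OneForm M (MinkEnd n)) (x : M) :
    (∀ X Y : TangentSpace 𝓘(ℝ, ℂ) x, extDD Λ α x X Y = 0) ↔
      α.extD₁ x - bracketWedge₁ (formN Λ) α x = 0 := by
  refine ⟨fun h => h (1 : ℂ) Complex.I, fun h X Y => ?_⟩
  obtain ⟨t, ht, hd⟩ := bracketWedge_expand (formN Λ) α x X Y
  rw [extDD, ht, hd, sub_eq_zero.1 h, sub_self]

theorem bracketWedge_star_star (α β : OneForm M (MinkEnd n)) (x : M) :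
    bracketWedge₁ α.star β.star x = bracketWedge₁ β α x := by
  refine ContinuousLinearMap.ext fun w => ?_
  simp only [bracketWedge₁, ev_star_one, ev_star_I, sub_apply, neg_apply, lie_apply_end, map_neg]
  abel

/-- This moves the star from 𝓝 onto q in the Euler-Lagrange equation. -/
theorem bracketWedge_star_right (α β : OneForm M (MinkEnd n)) (x : M) :
    bracketWedge₁ α β.star x = - bracketWedge₁ β α.star x := by
  refine ContinuousLinearMap.ext fun w => ?_
  simp only [bracketWedge₁, ev_star_one, ev_star_I, sub_apply, neg_apply, lie_apply_end, map_neg]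
  abel

theorem bracketWedge_add_smul_left (α β η : OneForm M (MinkEnd n)) (t : ℝ) (x : M)
    (X Y : TangentSpace 𝓘(ℝ, ℂ) x) :
    bracketWedge (α + t • β) η x X Y = bracketWedge α η x X Y + t • bracketWedge β η x X Y := by
  have e : ∀ X Y : ℂ, ⁅α.ev x X + t • β.ev x X, η.ev x Y⁆ - ⁅α.ev x Y + t • β.ev x Y, η.ev x X⁆ =
      (⁅α.ev x X, η.ev x Y⁆ - ⁅α.ev x Y, η.ev x X⁆) +
      t • (⁅β.ev x X, η.ev x Y⁆ - ⁅β.ev x Y, η.ev x X⁆) := by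
    intro X Y
    refine ContinuousLinearMap.ext fun w => ?_
    simp only [sub_apply, add_apply, smul_apply, lie_apply_end, map_add, map_smul]
    module
  exact e X Y

/-! ### Linear operations on admissible forms -/

theorem inChart_add_smul {F : Type*} [NormedAddCommGroup F] [NormedSpace ℝ F] (α β : OneForm M F)
    (t : ℝ) (x : M) : (α + t • β).inChart x = fun z => α.inChart x z + t • β.inChart x z := rfl

theorem IsAdmissible.add_smul {Λ : M → Submodule ℝ (Mink n)} {α β : OneForm M (MinkEnd n)}
    (hα : IsAdmissible Λ α) (hβ : IsAdmissible Λ β) (t : ℝ) : IsAdmissible Λ (α + t • β) where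
  smooth := fun x => by
    rw [inChart_add_smul]
    exact (hα.smooth x).add ((hβ.smooth x).const_smul t)
  mem := fun x X => add_mem (hα.mem x X) (Submodule.smul_mem _ t (hβ.mem x X))

theorem bil_add_smul (A B : ℂ → ℂ →L[ℝ] MinkEnd n) (s : ℂ → Mink n) (t : ℝ) (v w : ℂ) :
    bil (fun z => A z + t • B z) s v w = fun z => bil A s v w z + t • bil B s v w z := by
  funext z
  change -((A z v (pd w s z)).2 + t * (B z v (pd w s z)).2) =
    -(A z v (pd w s z)).2 + t * -(B z v (pd w s z)).2
  ring

theorem QuadAt.add_smul {A B : ℂ → ℂ →L[ℝ] MinkEnd n} {s : ℂ → Mink n} {z : ℂ}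
    (hA : QuadAt A s z) (hB : QuadAt B s z)
    (dA : ∀ v w, DifferentiableAt ℝ (bil A s v w) z)
    (dB : ∀ v w, DifferentiableAt ℝ (bil B s v w) z) (t : ℝ) :
    QuadAt (fun z => A z + t • B z) s z := by
  have e : ∀ u v w, pd u (fun z => bil A s v w z + t • bil B s v w z) z =
      pd u (bil A s v w) z + t • pd u (bil B s v w) z := by
    intro u v w
    rw [pd_add (dA v w) ((dB v w).fun_const_smul t), pd_smul (differentiableAt_const t) (dB v w),
      pd_const, zero_smul, zero_add]
  constructor
  · rw [bil_add_smul, bil_add_smul]; dsimp only; rw [hA.trace, hB.trace, smul_neg]; ring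
  · rw [bil_add_smul, bil_add_smul]; dsimp only; rw [hA.symm, hB.symm]
  · rw [bil_add_smul, bil_add_smul, e, e, hA.cr₁, hB.cr₁]
  · rw [bil_add_smul, bil_add_smul, e, e, hA.cr₂, hB.cr₂]

theorem bil_expand (A : ℂ → ℂ →L[ℝ] MinkEnd n) (s : ℂ → Mink n) (z v w : ℂ) : bil A s v w z =
    v.re * w.re * bil A s 1 1 z + v.re * w.im * bil A s 1 Complex.I z
      + v.im * w.re * bil A s Complex.I 1 z + v.im * w.im * bil A s Complex.I Complex.I z := by
  have e : A z v = v.re • A z 1 + v.im • A z Complex.I := by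
    rw [← map_smul, ← map_smul, ← map_add]
    congr 1
    simp [Complex.re_add_im]
  simp only [bil]
  rw [e, pd_dir_eq s z w]
  simp only [add_apply, smul_apply, map_add, map_smul, Prod.snd_add, Prod.smul_snd, smul_eq_mul]
  ring

theorem extD₁_eq {F : Type*} [NormedAddCommGroup F] [NormedSpace ℝ F] {α : OneForm M F}
    (hα : α.IsSmooth) (x : M) : α.extD₁ x =
      pd 1 (fun w => α.inChart x w Complex.I) (chartAt ℂ x x) -
        pd Complex.I (fun w => α.inChart x w 1) (chartAt ℂ x x) := by
  have hd := (hα x).diffAt (chartAt ℂ x).open_target (mem_chart_target ℂ x)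
  have e : ∀ u v : ℂ, pd u (fun w => α.inChart x w v) (chartAt ℂ x x) =
      fderiv ℝ (α.inChart x) (chartAt ℂ x x) u v := by
    intro u v
    have h := pd_apply hd (differentiableAt_const v) u
    rw [pd_const] at h
    exact h.trans (by simp [pd])
  rw [e, e]
  rfl

section Complex

variable [IsManifold 𝓘(ℂ) ω M] {Λ : M → Submodule ℝ (Mink n)} {σ : M → Mink n}
  {α : OneForm M (MinkEnd n)}

theorem inChart_center {F : Type*} [NormedAddCommGroup F] [NormedSpace ℝ F]
    (α : OneForm M F) (x : M) (v : ℂ) : α.inChart x (chartAt ℂ x x) v = α.ev x v := by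
  have h := inChart_apply α (mem_chart_target ℂ x) v
  rw [chartFactor_center, one_mul] at h
  exact h.trans (congrArg (fun y => α.ev y v) ((chartAt ℂ x).left_inv (mem_chart_source ℂ x)))

theorem ev_formN (hσ : IsNormalLift Λ σ) (hΛ : IsSurface Λ) (x : M) (v : ℂ) :
    (formN Λ).ev x v = patchN (localLift σ x) (chartAt ℂ x x) v := formN_eq hσ hΛ x v

theorem bracketWedge_formN (hσ : IsNormalLift Λ σ) (hΛ : IsSurface Λ) (α : OneForm M (MinkEnd n))
    (x : M) : bracketWedge₁ (formN Λ) α x =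
      ⁅patchN (localLift σ x) (chartAt ℂ x x) 1, α.inChart x (chartAt ℂ x x) Complex.I⁆ -
        ⁅patchN (localLift σ x) (chartAt ℂ x x) Complex.I, α.inChart x (chartAt ℂ x x) 1⁆ := by
  rw [bracketWedge₁, ev_formN hσ hΛ, ev_formN hσ hΛ, inChart_center, inChart_center]

theorem IsAdmissible.extDD_eq_zero_iff (hα : IsAdmissible Λ α) (hσ : IsNormalLift Λ σ)
    (hΛ : IsSurface Λ) (x : M) : (∀ X Y : TangentSpace 𝓘(ℝ, ℂ) x, extDD Λ α x X Y = 0) ↔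
      QuadAt (α.inChart x) (localLift σ x) (chartAt ℂ x x) := by
  rw [← (hσ.confPatch hΛ x).extDD_eq_zero_iff (mem_chart_target ℂ x) (hα.patchForm hσ hΛ x),
    CWSurface.extDD_eq_zero_iff, bracketWedge_formN hσ hΛ, extD₁_eq hα.smooth]

theorem IsAdmissible.of_extD_eq_zero (hα : IsAdmissible Λ α) (hσ : IsNormalLift Λ σ)
    (hΛ : IsSurface Λ) (x : M) (h0 : ∀ X Y : TangentSpace 𝓘(ℝ, ℂ) x, α.extD x X Y = 0) :
    QuadAt (α.inChart x) (localLift σ x) (chartAt ℂ x x) ∧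
      bracketWedge₁ (formN Λ) α x = 0 := by
  rw [bracketWedge_formN hσ hΛ]
  rw [extD_eq_zero_iff, extD₁_eq hα.smooth] at h0
  exact (hσ.confPatch hΛ x).of_ext_eq_zero (mem_chart_target ℂ x) (hα.patchForm hσ hΛ x) h0

/-- The Hodge star in a chart. -/
theorem inChart_star {F : Type*} [NormedAddCommGroup F] [NormedSpace ℝ F] (α : OneForm M F) {x : M}
    {z : ℂ} (hz : z ∈ (chartAt ℂ x).target) (v : ℂ) :
    α.star.inChart x z v = - α.inChart x z (Complex.I * v) := by
  have e : chartFactor x z * (Complex.I * v) = Complex.I * (chartFactor x z * v) := by ring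
  rw [inChart_apply _ hz, inChart_apply _ hz, e]
  rfl

theorem IsAdmissible.star (hα : IsAdmissible Λ α) : IsAdmissible Λ α.star where
  smooth := fun x => by
    have e : ∀ z ∈ (chartAt ℂ x).target, α.star.inChart x z =
        (ContinuousLinearMap.compL ℝ ℂ ℂ (MinkEnd n)).flip
          (-(ContinuousLinearMap.mul ℝ ℂ Complex.I)) (α.inChart x z) := by
      intro z hz
      refine ContinuousLinearMap.ext fun v => (inChart_star α hz v).trans ?_
      exact ((α.inChart x z).map_neg (Complex.I * v)).symm
    exact ((ContinuousLinearMap.contDiff _).comp_contDiffOn (hα.smooth x)).congr e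
  mem := fun x X => neg_mem (hα.mem x _)

theorem bil_star (α : OneForm M (MinkEnd n)) (s : ℂ → Mink n) {x : M} {z : ℂ}
    (hz : z ∈ (chartAt ℂ x).target) (v w : ℂ) :
    bil (α.star.inChart x) s v w z = - bil (α.inChart x) s (Complex.I * v) w z := by
  rw [bil, bil, inChart_star α hz]
  rfl

/-! ### Forms given by holomorphic quadratic differentials -/

/-- `α` is given by a holomorphic quadratic differential. -/
def IsQuad (σ : M → Mink n) (α : OneForm M (MinkEnd n)) : Prop :=
  ∀ x, QuadAt (α.inChart x) (localLift σ x) (chartAt ℂ x x)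

/-- `IsQuad` speaks only of chart centres. Being symmetric and trace-free is preserved when both
arguments are multiplied by the same complex number, so it holds throughout the chart. -/
theorem IsQuad.trace (hα : IsQuad σ α) (hσ : IsNormalLift Λ σ) {x : M} {z : ℂ}
    (hz : z ∈ (chartAt ℂ x).target) : bil (α.inChart x) (localLift σ x) Complex.I Complex.I z =
      - bil (α.inChart x) (localLift σ x) 1 1 z := by
  have h := hα ((chartAt ℂ x).symm z)
  rw [bil_eq hσ α hz rfl, bil_eq hσ α hz rfl, bil_expand, bil_expand _ _ _ (_ * 1), h.trace, h.symm]
  simp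
  ring

theorem IsQuad.symm (hα : IsQuad σ α) (hσ : IsNormalLift Λ σ) {x : M} {z : ℂ}
    (hz : z ∈ (chartAt ℂ x).target) : bil (α.inChart x) (localLift σ x) 1 Complex.I z =
      bil (α.inChart x) (localLift σ x) Complex.I 1 z := by
  have h := hα ((chartAt ℂ x).symm z)
  rw [bil_eq hσ α hz rfl, bil_eq hσ α hz rfl, bil_expand, bil_expand _ _ _ (_ * Complex.I) (_ * 1),
    h.trace, h.symm]
  simp
  ring

/-- The star multiplies the coefficient of the quadratic differential by -i, which exchanges the two
Cauchy-Riemann equations up to sign. The algebraic relations are differentiated here, so they are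
needed on the whole chart. -/
theorem IsQuad.star (hq : IsQuad σ α) (hσ : IsNormalLift Λ σ) : IsQuad σ α.star := by
  intro x
  have hz := mem_chart_target ℂ x
  have hU := (chartAt ℂ x).open_target
  have h1 : ∀ w, ∀ z ∈ (chartAt ℂ x).target, bil (α.star.inChart x) (localLift σ x) 1 w z =
      - bil (α.inChart x) (localLift σ x) Complex.I w z := fun w z hz => by
    rw [bil_star α _ hz, mul_one]
  have h2 : ∀ w, ∀ z ∈ (chartAt ℂ x).target, bil (α.star.inChart x) (localLift σ x) Complex.I w z =
      bil (α.inChart x) (localLift σ x) 1 w z := fun w z hz => by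
    rw [bil_star α _ hz, Complex.I_mul_I, bil_expand, bil_expand _ _ _ 1 w]
    simp [add_comm]
  have hneg : ∀ (f : ℂ → ℝ) v z, pd v (fun w => - f w) z = - pd v f z := by
    intro f v z
    rw [pd, fderiv_fun_neg]; rfl
  constructor
  · rw [h1 _ _ hz, h2 _ _ hz, neg_neg, hq.symm hσ hz]
  · rw [h1 _ _ hz, h2 _ _ hz, hq.trace hσ hz, neg_neg]
  · rw [pd_congr hU hz (h1 1), pd_congr hU hz (h2 1), hneg,
      pd_congr hU hz (fun w hw => (hq.symm hσ hw).symm), ← (hq x).cr₂,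
      pd_congr hU hz (fun w hw => hq.trace hσ hw), hneg, neg_neg]
  · rw [pd_congr hU hz (h1 Complex.I), pd_congr hU hz (h2 Complex.I), hneg,
      pd_congr hU hz (fun w hw => hq.symm hσ hw), (hq x).cr₁,
      pd_congr hU hz (fun w hw => hq.trace hσ hw), hneg, neg_neg]

theorem IsQuad.add_smul {β : OneForm M (MinkEnd n)} (hα : IsQuad σ α) (hβ : IsQuad σ β)
    (hσ : IsNormalLift Λ σ) (hΛ : IsSurface Λ) (aα : IsAdmissible Λ α) (aβ : IsAdmissible Λ β)
    (t : ℝ) : IsQuad σ (α + t • β) := by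
  intro x
  have hp := hσ.confPatch hΛ x
  rw [inChart_add_smul]
  exact (hα x).add_smul (hβ x)
    (fun v w => (hp.smooth_bil (aα.patchForm hσ hΛ x) v w).diffAt hp.isOpen (mem_chart_target ℂ x))
    (fun v w => (hp.smooth_bil (aβ.patchForm hσ hΛ x) v w).diffAt hp.isOpen (mem_chart_target ℂ x))
    t

/-! ### Multipliers and closed forms -/

theorem IsMultiplier.isQuad (hα : IsMultiplier Λ α) (hσ : IsNormalLift Λ σ) (hΛ : IsSurface Λ) :
    IsQuad σ α :=
  fun x => (hα.admissible.extDD_eq_zero_iff hσ hΛ x).1 (hα.closed x)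

theorem IsIsothermicPair.isQuad (hα : IsIsothermicPair Λ α) (hσ : IsNormalLift Λ σ)
    (hΛ : IsSurface Λ) : IsQuad σ α :=
  fun x => (hα.admissible.of_extD_eq_zero hσ hΛ x (hα.closed x)).1

/-- The star of the difference of two multipliers is closed. -/
theorem IsMultiplier.isIsothermicPair_star_sub {q₁ q₂ : OneForm M (MinkEnd n)}
    (hΛ : IsSurface Λ) (h₁ : IsMultiplier Λ q₁) (h₂ : IsMultiplier Λ q₂) (hne : q₁ ≠ q₂) :
    IsIsothermicPair Λ (OneForm.star (q₁ - q₂)) := by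
  obtain ⟨σ, hσ⟩ := hΛ.exists_normalLift
  have e : q₁ - q₂ = q₁ + (-1 : ℝ) • q₂ := by
    funext x
    refine ContinuousLinearMap.ext fun v => ?_
    change q₁ x v - q₂ x v = q₁ x v + (-1 : ℝ) • q₂ x v
    rw [neg_one_smul ℝ (q₂ x v : MinkEnd n), sub_eq_add_neg]
  have had : IsAdmissible Λ (q₁ - q₂) := e ▸ h₁.admissible.add_smul h₂.admissible (-1)
  have hq : IsQuad σ (q₁ - q₂) :=
    e ▸ (h₁.isQuad hσ hΛ).add_smul (h₂.isQuad hσ hΛ) hσ hΛ h₁.admissible h₂.admissible (-1)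
  refine ⟨had.star, fun h0 => ?_, fun x X Y => ?_⟩
  -- On one-forms ** = -1, so the star is injective.
  · have h := star_star (q₁ - q₂)
    rw [h0] at h
    refine hne (sub_eq_zero.1 (neg_eq_zero.1 (h.symm.trans ?_)))
    funext x
    refine ContinuousLinearMap.ext fun v => ?_
    exact neg_zero
  · revert X Y
    rw [extD_eq_zero_iff]
    have h1 := (had.star.extDD_eq_zero_iff hσ hΛ x).2 (hq.star hσ x)
    rw [CWSurface.extDD_eq_zero_iff] at h1
    have h2 : bracketWedge₁ (q₁ - q₂) (formN Λ).star x = 0 := by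
      have e1 := h₁.euler_lagrange x (1 : ℂ) Complex.I
      have e2 := h₂.euler_lagrange x (1 : ℂ) Complex.I
      have e3 := smul_right_injective (MinkEnd n) (two_ne_zero' ℝ) (e1.symm.trans e2)
      have e4 := bracketWedge_add_smul_left q₁ q₂ (formN Λ).star (-1) x (1 : ℂ) Complex.I
      rw [← e] at e4
      refine e4.trans ((congrArg (· + _) e3).trans ?_)
      refine (congrArg (_ + ·) (neg_one_smul ℝ (_ : MinkEnd n))).trans ?_
      exact add_neg_cancel _
    -- For q = q₁ - q₂, [𝓝 ∧ *q] = -[q ∧ *𝓝] = 0, so d*q coincides with d^𝓓 *q, which vanishes.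
    rwa [bracketWedge_star_right, h2, neg_zero, sub_zero] at h1

/-- Adding a multiple of `*η`, for a closed `η`, to a multiplier gives a multiplier. -/
theorem IsMultiplier.add_smul_star {q η : OneForm M (MinkEnd n)} (hΛ : IsSurface Λ)
    (hq : IsMultiplier Λ q) (hη : IsIsothermicPair Λ η) (t : ℝ) :
    IsMultiplier Λ (q + t • η.star) := by
  obtain ⟨σ, hσ⟩ := hΛ.exists_normalLift
  have had := hq.admissible.add_smul hη.admissible.star t
  have hquad := (hq.isQuad hσ hΛ).add_smul ((hη.isQuad hσ hΛ).star hσ) hσ hΛ hq.admissible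
    hη.admissible.star t
  refine ⟨had, fun x X Y => ?_, fun x X Y => ?_⟩
  · exact (had.extDD_eq_zero_iff hσ hΛ x).2 (hquad x) X Y
  -- [*η ∧ *𝓝] = [𝓝 ∧ η], which vanishes because η is closed.
  · have h0 : bracketWedge η.star (formN Λ).star x X Y = 0 := bracketWedge_eq_zero _ _ _ (by
      rw [bracketWedge_star_star, (hη.admissible.of_extD_eq_zero hσ hΛ x (hη.closed x)).2]) X Y
    rw [hq.euler_lagrange, bracketWedge_add_smul_left, h0, end_smul_zero, add_zero]

end Complex

end

section

variable {n : ℕ} {M : Type*} [TopologicalSpace M] [ChartedSpace ℂ M]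

/-! ### Holomorphic quadratic differentials -/

/-- The coefficient of the quadratic differential of `α` in the preferred chart at `x`. -/
def quadCoeff (σ : M → Mink n) (α : OneForm M (MinkEnd n)) (x : M) (z : ℂ) : ℂ :=
  (bil (α.inChart x) (localLift σ x) 1 1 z : ℂ) -
    Complex.I * (bil (α.inChart x) (localLift σ x) 1 Complex.I z : ℂ)

/-- A function `g` on a Riemann surface is regarded as the quadratic differential whose coefficient
at `x`, in the preferred chart at `x`, is `g x`; it is holomorphic if its coefficients in the
charts are. -/
def IsHolQuad (g : M → ℂ) : Prop :=
  ∀ x : M, DifferentiableOn ℂ (fun z => chartFactor x z ^ 2 * g ((chartAt ℂ x).symm z))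
    (chartAt ℂ x).target

theorem IsHolQuad.add_mul {g₁ g₂ : M → ℂ} (h₁ : IsHolQuad g₁) (h₂ : IsHolQuad g₂) (t : ℂ) :
    IsHolQuad fun x => g₁ x + t * g₂ x := by
  intro x
  refine ((h₁ x).add ((h₂ x).const_mul t)).congr fun z _ => ?_
  change _ = _ + t * _
  ring

section Complex

variable [IsManifold 𝓘(ℂ) ω M] {Λ : M → Submodule ℝ (Mink n)} {σ : M → Mink n}
  {α : OneForm M (MinkEnd n)}

/-- A symmetric trace-free form is b(v, w) = Re(Q v w) with Q = b(1, 1) - i b(1, i), so a conformal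
change of frame multiplies Q by the square of the factor. -/
theorem IsQuad.quadCoeff_eq (hα : IsQuad σ α) (hσ : IsNormalLift Λ σ) {x : M} {z : ℂ}
    (hz : z ∈ (chartAt ℂ x).target) : quadCoeff σ α x z = chartFactor x z ^ 2 *
      quadCoeff σ α ((chartAt ℂ x).symm z)
        (chartAt ℂ ((chartAt ℂ x).symm z) ((chartAt ℂ x).symm z)) := by
  have h := hα ((chartAt ℂ x).symm z)
  rw [quadCoeff, bil_eq hσ α hz rfl, bil_eq hσ α hz rfl, bil_expand,
    bil_expand _ _ _ (_ * 1) (_ * Complex.I), h.trace, ← h.symm, quadCoeff]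
  generalize bil _ _ 1 1 _ = a
  generalize bil _ _ 1 Complex.I _ = b
  generalize chartFactor x z = c
  apply Complex.ext
  · simp [pow_two]
    ring
  · simp [pow_two]
    ring

/-- With trace and symmetry known near the centre, `cr₁` and `cr₂` become the Cauchy-Riemann
equations for b(1, 1) and -b(1, i). -/
theorem IsQuad.differentiableAt_center (hα : IsQuad σ α) (hσ : IsNormalLift Λ σ)
    (hΛ : IsSurface Λ) (aα : IsAdmissible Λ α) (x : M) :
    DifferentiableAt ℂ (quadCoeff σ α x) (chartAt ℂ x x) := by
  have hz := mem_chart_target ℂ x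
  have hp := hσ.confPatch hΛ x
  have hb : ∀ v w, DifferentiableAt ℝ (bil (α.inChart x) (localLift σ x) v w) (chartAt ℂ x x) :=
    fun v w => (hp.smooth_bil (aα.patchForm hσ hΛ x) v w).diffAt hp.isOpen hz
  have hb' : ∀ v w, HasFDerivAt (fun z => (bil (α.inChart x) (localLift σ x) v w z : ℂ))
      (Complex.ofRealCLM.comp (fderiv ℝ (bil (α.inChart x) (localLift σ x) v w) (chartAt ℂ x x)))
      (chartAt ℂ x x) := fun v w =>
    Complex.ofRealCLM.hasFDerivAt.comp (chartAt ℂ x x) (hb v w).hasFDerivAt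
  have hd := (hb' 1 1).sub ((hb' 1 Complex.I).const_mul Complex.I)
  rw [differentiableAt_complex_iff_differentiableAt_real]
  refine ⟨hd.differentiableAt, ?_⟩
  have hd' : HasFDerivAt (quadCoeff σ α x) _ (chartAt ℂ x x) := hd
  rw [hd'.fderiv]
  have c1 := (hα x).cr₁
  have c2 := (hα x).cr₂
  rw [pd_congr hp.isOpen hz (fun w hw => (hα.symm hσ hw).symm)] at c1
  rw [pd_congr hp.isOpen hz (fun w hw => hα.trace hσ hw)] at c2
  have c3 : pd 1 (fun w => - bil (α.inChart x) (localLift σ x) 1 1 w) (chartAt ℂ x x) =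
      - pd 1 (bil (α.inChart x) (localLift σ x) 1 1) (chartAt ℂ x x) := by
    rw [pd, fderiv_fun_neg]; rfl
  rw [c3] at c2
  simp only [pd] at c1 c2
  simp only [sub_apply, smul_apply, ContinuousLinearMap.comp_apply, Complex.ofRealCLM_apply,
    smul_eq_mul, ← c1, ← c2]
  push_cast
  linear_combination (fderiv ℝ (bil (α.inChart x) (localLift σ x) 1 Complex.I)
    (chartAt ℂ x x) 1 : ℂ) * Complex.I_mul_I

/-- Differentiability is known only at centres. At z it is taken from the chart centred at the point
with coordinate z and transported by the holomorphic coordinate change. -/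
theorem IsQuad.isHolQuad (hα : IsQuad σ α) (hσ : IsNormalLift Λ σ)
    (hΛ : IsSurface Λ) (aα : IsAdmissible Λ α) :
    IsHolQuad fun x => quadCoeff σ α x (chartAt ℂ x x) := by
  intro x z hz
  refine DifferentiableAt.differentiableWithinAt ?_
  set y := (chartAt ℂ x).symm z with hy
  have ho : z ∈ overlap x y := mem_overlap hz
  have e : (fun w => chartFactor x w ^ 2 * quadCoeff σ α ((chartAt ℂ x).symm w)
        (chartAt ℂ ((chartAt ℂ x).symm w) ((chartAt ℂ x).symm w))) =ᶠ[𝓝 z]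
      fun w => quadCoeff σ α y (chartChange x y w) * deriv (chartChange x y) w ^ 2 := by
    filter_upwards [(isOpen_overlap x y).mem_nhds ho] with w hw
    rw [hα.quadCoeff_eq hσ (chartChange_mem hw), chartFactor_eq hw, symm_chartChange hw]
    ring
  refine DifferentiableAt.congr_of_eventuallyEq ?_ e
  have hτ := analyticAt_chartChange ho
  have h1 : DifferentiableAt ℂ (quadCoeff σ α y) (chartChange x y z) :=
    hα.differentiableAt_center hσ hΛ aα y
  exact (h1.comp z hτ.differentiableAt).mul (hτ.deriv.differentiableAt.pow 2)

/-- The identity theorem for holomorphic quadratic differentials. -/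
theorem IsHolQuad.eq_zero [ConnectedSpace M] {g : M → ℂ} (hg : IsHolQuad g) {x₀ : M}
    (h0 : ∀ᶠ y in 𝓝 x₀, g y = 0) (x : M) : g x = 0 := by
  have hclopen : IsClopen {x | ∀ᶠ y in 𝓝 x, g y = 0} := by
    constructor
    -- A ball in the chart at a limit point meets the set. The identity theorem on that ball gives
    -- vanishing on all of it, hence near the limit point.
    · refine isClosed_of_closure_subset fun x hx => ?_
      have hz := mem_chart_target ℂ x
      obtain ⟨r, hr, hb⟩ := Metric.isOpen_iff.1 (chartAt ℂ x).open_target _ hz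
      set B := Metric.ball (chartAt ℂ x x) r
      set F := fun z => chartFactor x z ^ 2 * g ((chartAt ℂ x).symm z)
      have hV : IsOpen ((chartAt ℂ x).source ∩ chartAt ℂ x ⁻¹' B) :=
        (chartAt ℂ x).isOpen_inter_preimage Metric.isOpen_ball
      have hxV : x ∈ (chartAt ℂ x).source ∩ chartAt ℂ x ⁻¹' B :=
        ⟨mem_chart_source ℂ x, Metric.mem_ball_self hr⟩
      obtain ⟨y, hyV, hy⟩ := mem_closure_iff.1 hx _ hV hxV
      have hF : AnalyticOnNhd ℂ F B := ((hg x).mono hb).analyticOnNhd Metric.isOpen_ball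
      have hFy : F =ᶠ[𝓝 (chartAt ℂ x y)] 0 := by
        have hc : Filter.Tendsto (chartAt ℂ x).symm (𝓝 (chartAt ℂ x y)) (𝓝 y) := by
          have := (chartAt ℂ x).continuousAt_symm ((chartAt ℂ x).map_source hyV.1)
          rwa [ContinuousAt, (chartAt ℂ x).left_inv hyV.1] at this
        filter_upwards [hc.eventually hy] with w hw
        simp [F, hw]
      have hz0 := hF.eqOn_zero_of_preconnected_of_eventuallyEq_zero
        (convex_ball _ _).isPreconnected hyV.2 hFy
      filter_upwards [hV.mem_nhds hxV] with p hp
      have := hz0 hp.2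
      simpa [F, (chartAt ℂ x).left_inv hp.1,
        chartFactor_ne_zero ((chartAt ℂ x).map_source hp.1)] using this
    · exact isOpen_setOfPred_eventually_nhds
  have := hclopen.eq_univ ⟨x₀, h0⟩
  have hx : x ∈ {x | ∀ᶠ y in 𝓝 x, g y = 0} := this ▸ mem_univ x
  exact hx.self_of_nhds

/-- An admissible form is determined by its quadratic differential. -/
theorem IsQuad.eq_zero_of_quadCoeff (hα : IsQuad σ α) (hσ : IsNormalLift Λ σ)
    (hΛ : IsSurface Λ) (aα : IsAdmissible Λ α)
    (h : ∀ x, quadCoeff σ α x (chartAt ℂ x x) = 0) : α = 0 := by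
  refine ext_ev fun x v => ?_
  have hz := mem_chart_target ℂ x
  have hq := h x
  have h11 : bil (α.inChart x) (localLift σ x) 1 1 (chartAt ℂ x x) = 0 := by
    have := congrArg Complex.re hq; simpa [quadCoeff] using this
  have h1I : bil (α.inChart x) (localLift σ x) 1 Complex.I (chartAt ℂ x x) = 0 := by
    have := congrArg Complex.im hq; simpa [quadCoeff] using this
  have hall : ∀ v w, bil (α.inChart x) (localLift σ x) v w (chartAt ℂ x x) = 0 := by
    intro v w
    rw [bil_expand, (hα x).trace, ← (hα x).symm, h11, h1I]
    ring
  rw [← inChart_center, (hσ.confPatch hΛ x).eq_wedge_tang hz (aα.patchForm hσ hΛ x), tang, hall,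
    hall, zero_smul, zero_smul, add_zero, smul_zero, wedge_zero_right]
  rfl

/-! ### Umbilic points -/

theorem hess_expand (hσ : IsNormalLift Λ σ) (hΛ : IsSurface Λ) (x : M) {z : ℂ}
    (hz : z ∈ (chartAt ℂ x).target) (v w : ℂ) : hess (localLift σ x) v w z =
      (v.re * w.re - v.im * w.im) • hess (localLift σ x) 1 1 z +
      (v.re * w.im + v.im * w.re) • hess (localLift σ x) 1 Complex.I z := by
  have hp := hσ.confPatch hΛ x
  have e1 : ∀ v w, hess (localLift σ x) v w z =
      v.re • hess (localLift σ x) 1 w z + v.im • hess (localLift σ x) Complex.I w z := by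
    intro v w
    rw [hess, pd_dir_eq (pd w _) z v, map_add, map_smul, map_smul, hess, hess]
    module
  rw [e1, hp.hess_comm hz 1 w, hp.hess_comm hz Complex.I w, e1 w 1, e1 w Complex.I,
    hp.hess_comm hz Complex.I 1, hp.hess_trace hz]
  module

theorem smooth_hess (hσ : IsNormalLift Λ σ) (hΛ : IsSurface Λ) (x : M) (v w : ℂ) :
    ContDiffOn ℝ ∞ (hess (localLift σ x) v w) (chartAt ℂ x).target := by
  have hp := hσ.confPatch hΛ x
  exact (hp.smooth_pd_pd v w).sub (contDiffOn_bilin (ContinuousLinearMap.id ℝ (MinkEnd n))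
    hp.smooth_patchProj (hp.smooth_pd_pd v w))

/-- The point `x` is umbilic. -/
def IsUmbilic (σ : M → Mink n) (x : M) : Prop :=
  hess (localLift σ x) 1 1 (chartAt ℂ x x) = 0 ∧
    hess (localLift σ x) 1 Complex.I (chartAt ℂ x x) = 0

theorem IsUmbilic.hess_eq_zero (hσ : IsNormalLift Λ σ) (hΛ : IsSurface Λ) {x : M} {z : ℂ}
    (hz : z ∈ (chartAt ℂ x).target) (h : IsUmbilic σ ((chartAt ℂ x).symm z)) (v w : ℂ) :
    hess (localLift σ x) v w z = 0 := by
  rw [hess_eq hσ hΛ hz rfl, hess_expand hσ hΛ _ (mem_chart_target ℂ _), h.1, h.2, smul_zero,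
    smul_zero, add_zero]

/-- Umbilicity of a nearby point is tested in its own chart; by tensoriality it can be tested in the
chart at x, where the Hessian is continuous. -/
theorem eventually_not_umbilic (hσ : IsNormalLift Λ σ) (hΛ : IsSurface Λ) {x : M}
    (h : ¬ IsUmbilic σ x) :
    ∀ᶠ z in 𝓝 (chartAt ℂ x x), ¬ IsUmbilic σ ((chartAt ℂ x).symm z) := by
  have hz := mem_chart_target ℂ x
  have hU := (chartAt ℂ x).open_target
  have hne : ∀ v w, hess (localLift σ x) v w (chartAt ℂ x x) ≠ 0 →
      ∀ᶠ z in 𝓝 (chartAt ℂ x x), ¬ IsUmbilic σ ((chartAt ℂ x).symm z) := by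
    intro v w hvw
    have hc := ((smooth_hess hσ hΛ x v w).diffAt hU hz).continuousAt
    filter_upwards [hc.eventually_ne hvw, hU.mem_nhds hz] with z h1 h2 h3
    exact h1 (h3.hess_eq_zero hσ hΛ h2 v w)
  rw [IsUmbilic, not_and_or] at h
  exact h.elim (hne 1 1) (hne 1 Complex.I)

/-- If all points are umbilic, the central sphere congruence is constant. -/
theorem projS_eq_of_umbilic [ConnectedSpace M] (hσ : IsNormalLift Λ σ) (hΛ : IsSurface Λ)
    (h : ∀ x, IsUmbilic σ x) (x y : M) : projS Λ x = projS Λ y := by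
  refine IsLocallyConstant.apply_eq_of_isPreconnected (f := projS Λ) ?_ isPreconnected_univ
    (mem_univ x) (mem_univ y)
  rw [IsLocallyConstant.iff_eventually_eq]
  intro x
  have hz := mem_chart_target ℂ x
  have hp := hσ.confPatch hΛ x
  obtain ⟨r, hr, hb⟩ := Metric.isOpen_iff.1 (chartAt ℂ x).open_target _ hz
  have hV : IsOpen ((chartAt ℂ x).source ∩ chartAt ℂ x ⁻¹' Metric.ball (chartAt ℂ x x) r) :=
    (chartAt ℂ x).isOpen_inter_preimage Metric.isOpen_ball
  have h0 : ∀ v w, ∀ z ∈ (chartAt ℂ x).target, patchProj (localLift σ x) z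
      (pd v (pd w (localLift σ x)) z) = pd v (pd w (localLift σ x)) z := fun v w z hz =>
    (sub_eq_zero.1 ((h _).hess_eq_zero hσ hΛ hz v w)).symm
  filter_upwards [hV.mem_nhds ⟨mem_chart_source ℂ x, Metric.mem_ball_self hr⟩] with y hy
  have key := Metric.isOpen_ball.is_const_of_fderiv_eq_zero (𝕜 := ℝ)
    (f := patchProj (localLift σ x)) (convex_ball (chartAt ℂ x x) r).isPreconnected
    (fun z hz => (hp.diffAt_patchProj (hb hz)).differentiableWithinAt)
    (fun z hz => ContinuousLinearMap.ext fun v =>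
      hp.pd_patchProj_eq_zero (hb hz) (h0 1 1) (h0 1 Complex.I) v)
    hy.2 (Metric.mem_ball_self hr)
  rwa [← projS_eq hσ hΛ (hb hy.2), ← projS_eq hσ hΛ hz, (chartAt ℂ x).left_inv hy.1,
    (chartAt ℂ x).left_inv (mem_chart_source ℂ x)] at key

/-- The normal space of a sphere of dimension two contains a space-like vector. -/
theorem IsFrame.exists_normal (hn : 3 ≤ n) {a b c d : Mink n} (h : IsFrame a b c d)
    (ha : a.2 = 1) : ∃ v : Mink n, 0 < lor n v v ∧ ∀ w, lor n (frameProj a b c d w) v = 0 := by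
  let f : Mink n →ₗ[ℝ] Fin 4 → ℝ := LinearMap.pi ![lor n a, lor n b, lor n c, lor n d]
  have hker : LinearMap.ker f ≠ ⊥ := by
    -- Four linear conditions on a space of dimension n + 2 ≥ 5.
    apply LinearMap.ker_ne_bot_of_finrank_lt
    simp
    omega
  obtain ⟨v, hv, hv0⟩ := (Submodule.ne_bot_iff _).1 hker
  have hv' : ∀ i, f v i = 0 := fun i => congrFun (LinearMap.mem_ker.1 hv) i
  have va : lor n a v = 0 := hv' 0
  have vb : lor n b v = 0 := hv' 1
  have vc : lor n c v = 0 := hv' 2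
  have vd : lor n d v = 0 := hv' 3
  refine ⟨v, ?_, fun w => ?_⟩
  · have haa := h.aa
    rw [lor_apply, ha] at haa va
    -- As a is null with last coordinate 1 and (a, v) = 0, (v, v) is the Euclidean square of v.1 -
    -- v.2 • a.1. It vanishes only if v is a multiple of a, and (d, v) = 0 with (d, a) ≠ 0 excludes
    -- this.
    have hsq : inner ℝ (v.1 - v.2 • a.1) (v.1 - v.2 • a.1) = lor n v v := by
      rw [inner_sub_left, inner_sub_right, inner_sub_right, real_inner_smul_left,
        real_inner_smul_right, real_inner_smul_right, real_inner_smul_left, lor_apply,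
        real_inner_comm a.1 v.1]
      linear_combination (-2 * v.2) * va + v.2 ^ 2 * haa
    rw [← hsq]
    refine real_inner_self_pos.2 fun h1 => ?_
    have hva : v = v.2 • a := by
      refine Prod.ext ?_ ?_
      · exact sub_eq_zero.1 h1
      · rw [Prod.smul_snd, ha, smul_eq_mul, mul_one]
    rw [hva, map_smul, lor_comm, h.ad, smul_eq_mul, mul_eq_zero] at vd
    have hp := h.pos
    rcases vd with vd | vd
    · exact hv0 (by rw [hva, vd, zero_smul])
    · linarith
  · rw [lor_frameProj, frameProj_apply, va, vb, vc, vd]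
    simp

/-- If every point were umbilic, S would be constant and contain every line Λ. A space-like vector
of its orthogonal complement would then define a hypersphere containing the image. -/
theorem exists_not_umbilic [ConnectedSpace M] (hn : 3 ≤ n) (hσ : IsNormalLift Λ σ)
    (hΛ : IsSurface Λ) : ∃ x, ¬ IsUmbilic σ x := by
  by_contra! h
  obtain ⟨x⟩ := (inferInstance : Nonempty M)
  have hz := mem_chart_target ℂ x
  obtain ⟨v, hv, hv0⟩ := ((hσ.confPatch hΛ x).isFrame hz).exists_normal hn
    ((hσ.confPatch hΛ x).snd_eq _ hz)
  obtain ⟨y, w, hw, hne⟩ := hΛ.full v hv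
  have hw' : projS Λ y w = w := by
    rw [hσ.lift.span_eq] at hw
    obtain ⟨t, rfl⟩ := Submodule.mem_span_singleton.1 hw
    have hy := mem_chart_target ℂ y
    have e := (hσ.confPatch hΛ y).patchProj_s hy
    rw [← projS_eq hσ hΛ hy, (chartAt ℂ y).left_inv (mem_chart_source ℂ y), localLift_center] at e
    rw [map_smul, e]
  have e := projS_eq hσ hΛ hz
  rw [(chartAt ℂ x).left_inv (mem_chart_source ℂ x)] at e
  rw [← hw', projS_eq_of_umbilic hσ hΛ h y x, e] at hne
  exact hne (hv0 w)

/-- A holomorphic function with real values is locally constant. -/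
theorem exists_real_const {f : ℂ → ℂ} {z : ℂ} {r : ℝ} (hr : 0 < r)
    (hf : DifferentiableOn ℂ f (Metric.ball z r)) (him : ∀ w ∈ Metric.ball z r, (f w).im = 0) :
    ∃ t : ℝ, ∀ w ∈ Metric.ball z r, f w = t := by
  have hc : ∀ w ∈ Metric.ball z r, f w = f z := fun w hw => by
    refine Metric.isOpen_ball.is_const_of_deriv_eq_zero (convex_ball z r).isPreconnected hf
      (fun u hu => ?_) hw (Metric.mem_ball_self hr)
    have hd := (hf.differentiableAt (Metric.isOpen_ball.mem_nhds hu)).hasDerivAt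
    have hR := Complex.imCLM.hasFDerivAt.comp u (hd.hasFDerivAt.restrictScalars ℝ)
    have h0 : (fun w => (f w).im) =ᶠ[𝓝 u] fun _ => (0 : ℝ) :=
      Filter.eventuallyEq_of_mem (Metric.isOpen_ball.mem_nhds hu) him
    have hz := hR.unique ((hasFDerivAt_const (0 : ℝ) u).congr_of_eventuallyEq h0)
    -- The derivative of Im f is Im f' in direction 1 and Re f' in direction i.
    have e1 := congrArg (fun T : ℂ →L[ℝ] ℝ => T 1) hz
    have e2 := congrArg (fun T : ℂ →L[ℝ] ℝ => T Complex.I) hz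
    simp at e1 e2
    exact Complex.ext e2 e1
  refine ⟨(f z).re, fun w hw => ?_⟩
  rw [hc w hw]
  exact Complex.ext (by simp) (by simpa using him z (Metric.mem_ball_self hr))

end Complex

end

variable {n : ℕ} {M : Type*} [TopologicalSpace M] [ChartedSpace ℂ M]

/-! ### Uniqueness of isothermic structures and of multipliers -/

theorem star_ne_zero {η : OneForm M (MinkEnd n)} (h : η ≠ 0) : η.star ≠ 0 := by
  intro h0
  have e := star_star η
  rw [h0] at e
  refine h (neg_eq_zero.1 (e.symm.trans ?_))
  exact ext_ev fun x v => neg_zero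

section Complex

variable [IsManifold 𝓘(ℂ) ω M] {Λ : M → Submodule ℝ (Mink n)} {σ : M → Mink n}

/-- At non-umbilic points, the quadratic differentials of closed forms are real multiples of each
other. -/
theorem im_quadCoeff_mul_conj {η₁ η₂ : OneForm M (MinkEnd n)} (hσ : IsNormalLift Λ σ)
    (hΛ : IsSurface Λ) (h₁ : IsIsothermicPair Λ η₁) (h₂ : IsIsothermicPair Λ η₂) {x : M}
    (hx : ¬ IsUmbilic σ x) : (quadCoeff σ η₁ x (chartAt ℂ x x) *
      (starRingEnd ℂ) (quadCoeff σ η₂ x (chartAt ℂ x x))).im = 0 := by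
  have hz := mem_chart_target ℂ x
  have rel : ∀ η, IsIsothermicPair Λ η →
      bil (η.inChart x) (localLift σ x) 1 Complex.I (chartAt ℂ x x) •
        hess (localLift σ x) 1 1 (chartAt ℂ x x) =
      bil (η.inChart x) (localLift σ x) 1 1 (chartAt ℂ x x) •
        hess (localLift σ x) 1 Complex.I (chartAt ℂ x x) := by
    intro η h
    have h0 := h.admissible.of_extD_eq_zero hσ hΛ x (h.closed x)
    rw [bracketWedge_formN hσ hΛ] at h0
    exact (hσ.confPatch hΛ x).bracket_relation hz (h.admissible.patchForm hσ hΛ x) h0.1 h0.2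
  have r₁ := rel η₁ h₁
  have r₂ := rel η₂ h₂
  have key : bil (η₁.inChart x) (localLift σ x) 1 1 (chartAt ℂ x x) *
      bil (η₂.inChart x) (localLift σ x) 1 Complex.I (chartAt ℂ x x) -
      bil (η₁.inChart x) (localLift σ x) 1 Complex.I (chartAt ℂ x x) *
      bil (η₂.inChart x) (localLift σ x) 1 1 (chartAt ℂ x x) = 0 := by
    -- The two relations form a linear system for the two Hessian components. A non-zero determinant
    -- would make both vanish, so the point would be umbilic.
    by_contra hne
    refine hx ⟨(smul_eq_zero.1 ?_).resolve_left hne, (smul_eq_zero.1 ?_).resolve_left hne⟩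
    · rw [sub_smul, mul_smul, r₂, mul_comm, mul_smul, r₁, smul_comm, sub_self]
    · rw [sub_smul, mul_comm, mul_smul, ← r₁, mul_smul, ← r₂, smul_comm, sub_self]
  rw [quadCoeff, quadCoeff]
  simp
  linarith

/-- Closed non-zero forms with values in `Λ ∧ Λ^{(1)}` are unique up to scale. -/
theorem IsIsothermicPair.exists_eq_smul [ConnectedSpace M] (hn : 3 ≤ n)
    {η₁ η₂ : OneForm M (MinkEnd n)} (hΛ : IsSurface Λ)
    (h₁ : IsIsothermicPair Λ η₁) (h₂ : IsIsothermicPair Λ η₂) : ∃ t : ℝ, η₁ = t • η₂ := by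
  obtain ⟨σ, hσ⟩ := hΛ.exists_normalLift
  set g₁ : M → ℂ := fun x => quadCoeff σ η₁ x (chartAt ℂ x x) with hg₁
  set g₂ : M → ℂ := fun x => quadCoeff σ η₂ x (chartAt ℂ x x) with hg₂
  have q₁ := h₁.isQuad hσ hΛ
  have q₂ := h₂.isQuad hσ hΛ
  have hol₁ : IsHolQuad g₁ := q₁.isHolQuad hσ hΛ h₁.admissible
  have hol₂ : IsHolQuad g₂ := q₂.isHolQuad hσ hΛ h₂.admissible
  obtain ⟨x, hx⟩ := exists_not_umbilic hn hσ hΛ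
  have hz := mem_chart_target ℂ x
  have hV := Filter.Eventually.and (eventually_not_umbilic hσ hΛ hx)
    ((chartAt ℂ x).open_target.mem_nhds hz)
  obtain ⟨r, hr, hB⟩ := Metric.eventually_nhds_iff_ball.1 hV
  set B := Metric.ball (chartAt ℂ x x) r
  set F₁ : ℂ → ℂ := fun z => chartFactor x z ^ 2 * g₁ ((chartAt ℂ x).symm z)
  set F₂ : ℂ → ℂ := fun z => chartFactor x z ^ 2 * g₂ ((chartAt ℂ x).symm z)
  have hBt : B ⊆ (chartAt ℂ x).target := fun z hz => (hB z hz).2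
  have lift : ∀ {g : M → ℂ} {z : ℂ}, z ∈ (chartAt ℂ x).target →
      (∀ᶠ w in 𝓝 z, g ((chartAt ℂ x).symm w) = 0) →
      ∀ᶠ y in 𝓝 ((chartAt ℂ x).symm z), g y = 0 := by
    intro g z hz h
    have hs := (chartAt ℂ x).map_target hz
    have hc := (chartAt ℂ x).continuousAt hs
    rw [ContinuousAt, (chartAt ℂ x).right_inv hz] at hc
    filter_upwards [hc.eventually h, (chartAt ℂ x).open_source.mem_nhds hs] with y hy hys
    rwa [(chartAt ℂ x).left_inv hys] at hy
  -- If the differential of η₂ vanished on the whole ball, the identity theorem would give η₂ = 0.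
  obtain ⟨z₁, hz₁, hne⟩ : ∃ z ∈ B, F₂ z ≠ 0 := by
    by_contra! h0
    refine h₂.ne_zero (q₂.eq_zero_of_quadCoeff hσ hΛ h₂.admissible
      (hol₂.eq_zero (lift hz ?_)))
    filter_upwards [Metric.ball_mem_nhds (chartAt ℂ x x) hr] with w hw
    have := h0 w hw
    simpa [F₂, chartFactor_ne_zero (hBt hw)] using this
  have hc₂ : ContinuousAt F₂ z₁ := ((hol₂ x).differentiableAt
    ((chartAt ℂ x).open_target.mem_nhds (hBt hz₁))).continuousAt
  obtain ⟨r', hr', hB'⟩ := Metric.eventually_nhds_iff_ball.1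
    ((hc₂.eventually_ne hne).and (Metric.isOpen_ball.mem_nhds hz₁))
  -- The quotient is holomorphic where F₂ ≠ 0, and real because its points are non-umbilic; the
  -- squared chart factors cancel.
  obtain ⟨t, ht⟩ := exists_real_const (f := fun z => F₁ z / F₂ z) hr'
    (((hol₁ x).mono fun z hz => hBt (hB' z hz).2).div
      ((hol₂ x).mono fun z hz => hBt (hB' z hz).2) fun z hz => (hB' z hz).1)
    (fun w hw => by
      have hk := im_quadCoeff_mul_conj hσ hΛ h₁ h₂ (hB w (hB' w hw).2).1
      have hcf : chartFactor x w ^ 2 ≠ 0 := pow_ne_zero 2 (chartFactor_ne_zero (hBt (hB' w hw).2))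
      change (chartFactor x w ^ 2 * g₁ ((chartAt ℂ x).symm w) /
        (chartFactor x w ^ 2 * g₂ ((chartAt ℂ x).symm w))).im = 0
      rw [mul_div_mul_left _ _ hcf, Complex.div_im]
      simp only [Complex.mul_im, Complex.conj_re, Complex.conj_im] at hk
      rw [← sub_div]
      change (g₁ _).re * -(g₂ _).im + (g₁ _).im * (g₂ _).re = 0 at hk
      rw [show (g₁ ((chartAt ℂ x).symm w)).im * (g₂ ((chartAt ℂ x).symm w)).re -
        (g₁ ((chartAt ℂ x).symm w)).re * (g₂ ((chartAt ℂ x).symm w)).im = 0 by linarith, zero_div])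
  refine ⟨t, ?_⟩
  have had := h₁.admissible.add_smul h₂.admissible (-t)
  have hq := q₁.add_smul q₂ hσ hΛ h₁.admissible h₂.admissible (-t)
  have hcoeff : ∀ y, quadCoeff σ (η₁ + (-t) • η₂) y (chartAt ℂ y y) = g₁ y + (-t : ℂ) * g₂ y := by
    intro y
    simp only [hg₁, hg₂, quadCoeff]
    rw [inChart_add_smul, bil_add_smul, bil_add_smul]
    push_cast [smul_eq_mul]
    ring
  -- The differential of η₁ - tη₂ is holomorphic and vanishes near z₁, hence everywhere, and an
  -- admissible form of this kind is determined by it.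
  have h0 : η₁ + (-t) • η₂ = 0 := by
    refine hq.eq_zero_of_quadCoeff hσ hΛ had fun y => ?_
    rw [hcoeff]
    refine (hol₁.add_mul hol₂ (-t : ℂ)).eq_zero (lift (hBt hz₁) ?_) y
    filter_upwards [Metric.ball_mem_nhds z₁ hr'] with w hw
    have e := ht w hw
    have hcf : chartFactor x w ^ 2 ≠ 0 := pow_ne_zero 2 (chartFactor_ne_zero (hBt (hB' w hw).2))
    rw [div_eq_iff (hB' w hw).1] at e
    have e' : chartFactor x w ^ 2 * g₁ ((chartAt ℂ x).symm w) =
      t * (chartFactor x w ^ 2 * g₂ ((chartAt ℂ x).symm w)) := e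
    refine (mul_eq_zero.1 ?_).resolve_left hcf
    linear_combination e'
  refine ext_ev fun y v => ?_
  have e : η₁.ev y v + (-t) • η₂.ev y v = 0 := congrArg (fun α : OneForm M (MinkEnd n) => α.ev y v) h0
  refine ContinuousLinearMap.ext fun w => ?_
  have e2 : η₁.ev y v w + (-t) • η₂.ev y v w = 0 := congrArg (fun T : MinkEnd n => T w) e
  rw [neg_smul, ← sub_eq_add_neg, sub_eq_zero] at e2
  exact e2

theorem IsMultiplier.exists_eq_add_smul_star [ConnectedSpace M] (hn : 3 ≤ n)
    {q q' η : OneForm M (MinkEnd n)} (hΛ : IsSurface Λ) (hq : IsMultiplier Λ q)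
    (hq' : IsMultiplier Λ q') (hη : IsIsothermicPair Λ η) : ∃ t : ℝ, q' = q + t • η.star := by
  by_cases hne : q' = q
  · refine ⟨0, ext_ev fun x v => ContinuousLinearMap.ext fun w => ?_⟩
    rw [hne]
    change _ = q.ev x v w + (0 : ℝ) • η.star.ev x v w
    rw [zero_smul, add_zero]
  obtain ⟨t, ht⟩ := (hq'.isIsothermicPair_star_sub hΛ hq hne).exists_eq_smul hn hΛ hη
  -- From *(q' - q) = tη, a second star gives q' - q = -t *η.
  refine ⟨-t, ext_ev fun x v => ContinuousLinearMap.ext fun w => ?_⟩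
  have e := star_star (q' - q)
  rw [ht] at e
  have e2 : -(t • η.ev x (Complex.I * v) w) = -(q'.ev x v w - q.ev x v w) :=
    congrArg (fun α : OneForm M (MinkEnd n) => α.ev x v w) e
  change q'.ev x v w = q.ev x v w + (-t) • -(η.ev x (Complex.I * v) w)
  rw [neg_smul, smul_neg, neg_neg, neg_inj.1 e2]
  abel

end Complex

end CWSurface

end

/-! ### The theorem on multipliers -/

theorem mainTheorem8 {n : ℕ} (hn : 3 ≤ n) {M : Type*} [TopologicalSpace M] [ConnectedSpace M]
    [ChartedSpace ℂ M] [IsManifold 𝓘(ℂ) ω M]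
    (Λ : M → Submodule ℝ (CWSurface.Mink n)) (hΛ : CWSurface.IsSurface Λ) :
    (CWSurface.IsConstrainedWillmore Λ →
      ((∃! q, CWSurface.IsMultiplier Λ q) ↔ ¬ CWSurface.IsIsothermic Λ)) ∧
    (∀ q₁ q₂, CWSurface.IsMultiplier Λ q₁ → CWSurface.IsMultiplier Λ q₂ → q₁ ≠ q₂ →
      CWSurface.IsIsothermicPair Λ (CWSurface.OneForm.star (q₁ - q₂))) ∧
    (∀ η q, CWSurface.IsIsothermicPair Λ η → CWSurface.IsMultiplier Λ q →
      {q' | CWSurface.IsMultiplier Λ q'} =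
        {q' | ∃ t : ℝ, q' = q + t • CWSurface.OneForm.star η}) := by
  refine ⟨fun hCW => ⟨?_, fun hI => ?_⟩, fun q₁ q₂ h₁ h₂ hne =>
    h₁.isIsothermicPair_star_sub hΛ h₂ hne, fun η q hη hq => ?_⟩
  · rintro ⟨q, hq, huniq⟩ ⟨η, hη⟩
    -- A closed non-zero η would make q + *η a multiplier, and uniqueness would force *η = 0.
    have e := huniq _ (CWSurface.IsMultiplier.add_smul_star hΛ hq hη 1)
    refine CWSurface.star_ne_zero hη.ne_zero (CWSurface.ext_ev fun x v => ?_)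
    have e2 : q.ev x v + (1 : ℝ) • η.star.ev x v = q.ev x v :=
      congrArg (fun α : CWSurface.OneForm M (CWSurface.MinkEnd n) => α.ev x v) e
    refine ContinuousLinearMap.ext fun w => ?_
    have e3 : q.ev x v w + (1 : ℝ) • η.star.ev x v w = q.ev x v w :=
      congrArg (fun T : CWSurface.MinkEnd n => T w) e2
    rw [one_smul, add_eq_left] at e3
    exact e3
  · obtain ⟨q, hq⟩ := hCW
    refine ⟨q, hq, fun q' hq' => ?_⟩
    by_contra hne
    exact hI ⟨_, CWSurface.IsMultiplier.isIsothermicPair_star_sub hΛ hq' hq hne⟩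
  · ext q'
    constructor
    · exact fun hq' => hq.exists_eq_add_smul_star hn hΛ hq' hη
    · rintro ⟨t, rfl⟩
      exact hq.add_smul_star hΛ hη t
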